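/- **Lemma 10.1 (the Fackerell–Ipser equation for $\rho$ in the MBI system).** Let $M>0$ and let $(\mathcal S,g)$ be the Schwarzschild spacetime, $\mathcal S=\{(t^*,r,\omega)\in\mathbb R\times(0,\infty)\times\mathbb S^2\}$ with $$g=-(1-\mu)\,dt^{*2}+2\mu\,dt^*dr+(1+\mu)\,dr^2+r^2g_{\mathbb S^2},\qquad \mu=\tfrac{2M}{r},$$ Levi-Civita connection $\nabla$ and volume form $\varepsilon$. Let $$L=\partial_t+\partial_{r_*}=(1+\mu)\partial_{t^*}+(1-\mu)\partial_r,\qquad \underline L=\partial_t-\partial_{r_*}=(1-\mu)(\partial_{t^*}-\partial_r)$$ (with $\partial_{t^*},\partial_r$ taken in the coordinates $(t^*,r,\omega)$), and let $\slashed\Delta$ be the Laplacian on the spheres of constant $(t^*,r)$ with the induced metric. For a two-form $\mathcal F$ put ${}^\star\mathcal F_{\mu\nu}=\frac12\varepsilon_{\mu\nu\kappa\lambda}\mathcal F^{\kappa\lambda}$, $\mathbf F=\frac12\mathcal F_{\mu\nu}\mathcal F^{\mu\nu}$, $\mathbf G=\frac14\mathcal F_{\mu\nu}{}^\star\mathcal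 F^{\mu\nu}$, $\ell=\sqrt{1+\mathbf F-\mathbf G^2}$, $$H_\Delta^{\mu\nu\kappa\lambda}=\tfrac12\Big\{-\ell^{-2}\mathcal F^{\mu\nu}\mathcal F^{\kappa\lambda}+\mathbf G\,\ell^{-2}\big(\mathcal F^{\mu\nu}\,{}^\star\mathcal F^{\kappa\lambda}+{}^\star\mathcal F^{\mu\nu}\mathcal F^{\kappa\lambda}\big)-\big(1+\mathbf G^2\ell^{-2}\big){}^\star\mathcal F^{\mu\nu}\,{}^\star\mathcal F^{\kappa\lambda}\Big\},$$ $$H^{\mu\nu\kappa\lambda}=\tfrac12\big(g^{\mu\kappa}g^{\nu\lambda}-g^{\mu\lambda}g^{\nu\kappa}\big)+H_\Delta^{\mu\nu\kappa\lambda},$$ and let $$\rho=\tfrac12(1-\mu)^{-1}\mathcal F(\underline L,L),$$ extended smoothly across $r=2M$ (that is, $\rho=\tfrac12\mathcal F(\partial_{t^*}-\partial_r,L)$). Let $U\subseteq\mathcal S$ be open and let $\mathcal F$ be a smooth two-form on $U$ with $1+\mathbf F-\mathbf G^2>0$ which satisfies the Maxwell–Born–Infeld system $$\nabla_{[\mu}\mathcal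 F_{\nu\lambda]}=0,\qquad H^{\mu\nu\kappa\lambda}\nabla_\mu\mathcal F_{\kappa\lambda}=0\qquad\text{on }U.$$ Then on $U$ $$-r^{-2}L\underline L(r^2\rho)+(1-\mu)\slashed\Delta\rho=-\tfrac12\,(\mathrm{NL}_1+\mathrm{NL}_2),$$ where, with $N_\nu=(H_\Delta)^{\mu}{}_{\nu}{}^{\kappa\lambda}\nabla_\mu\mathcal F_{\kappa\lambda}$, $$\mathrm{NL}_1=2\,\frac{1-\mu}{r}\big(-\underline L^\nu N_\nu\big)-2\,\frac{1-\mu}{r}\,L^\nu N_\nu ,$$ $$\mathrm{NL}_2=L^\nu\underline L^\alpha\big(\nabla_\alpha N_\nu-\nabla_\nu N_\alpha\big)=L^\nu\underline L^\alpha\big(-\nabla_\alpha\nabla^\mu\mathcal F_{\mu\nu}+\nabla_\nu\nabla^\mu\mathcal F_{\mu\alpha}\big).$$ -/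

import Mathlib

open scoped ContDiff

noncomputable section

namespace MBI

/-! ### Tensor calculus in a global chart of the Schwarzschild spacetime

The Schwarzschild spacetime of mass `M`, with coordinates `(t*, r, ω) ∈ ℝ × (0, ∞) × S²`, is covered
by the single chart `(t*, x)`, `x = r ω ∈ ℝ³ \ {0}`; no poles have to be removed. Index `0` is `t*`
and the indices `1, 2, 3` are the Cartesian coordinates `x`. All tensors are given by their
components in this chart. -/

/-- Points (and tangent vectors) in the coordinates `(t*, x₁, x₂, x₃)`. -/
abbrev Pt := Fin 4 → ℝ

/-- The partial derivative `∂_i φ`. -/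
def pd (i : Fin 4) (φ : Pt → ℝ) (p : Pt) : ℝ := fderiv ℝ φ p (Pi.single i 1)

/-- The derivative `X φ` of a function along a vector field. -/
def along (X : Pt → Pt) (φ : Pt → ℝ) (p : Pt) : ℝ := ∑ i, X p i * pd i φ p

/-- The area radius `r = |x|`. -/
def rad (p : Pt) : ℝ := √(p 1 ^ 2 + p 2 ^ 2 + p 3 ^ 2)

/-- The Schwarzschild spacetime `{r > 0}`: exterior, future horizon and black hole region. -/
def spacetime : Set Pt := {p | 0 < rad p}

/-- `μ = 2M / r`. -/
def mu (M : ℝ) (p : Pt) : ℝ := 2 * M / rad p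

/-- The vector field `∂_r` of the coordinates `(t*, r, ω)`: it is `x / r` in Cartesian components. -/
def dr (p : Pt) : Pt := ![0, p 1 / rad p, p 2 / rad p, p 3 / rad p]

/-- The vector field `∂_{t*}` (equal to `∂_t`). -/
def dt (_p : Pt) : Pt := ![1, 0, 0, 0]

/-- The components of the one-form `dt* + dr`. -/
def dtdr (p : Pt) : Fin 4 → ℝ := ![1, p 1 / rad p, p 2 / rad p, p 3 / rad p]

/-- The Schwarzschild metric
`g = -(1 - μ) dt*² + 2 μ dt* dr + (1 + μ) dr² + r² g_{S²} = (-dt*² + |dx|²) + μ (dt* + dr)²`. -/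
def metric (M : ℝ) (p : Pt) : Matrix (Fin 4) (Fin 4) ℝ :=
  Matrix.of fun a b =>
    Matrix.diagonal ![(-1 : ℝ), 1, 1, 1] a b + mu M p * dtdr p a * dtdr p b

/-- The inverse metric `g^{ab}`. -/
def ginv (M : ℝ) (p : Pt) : Matrix (Fin 4) (Fin 4) ℝ := (metric M p)⁻¹

/-- The Christoffel symbols `Γ^s_{ab}` of the Levi-Civita connection of `g`. -/
def christoffel (M : ℝ) (s a b : Fin 4) (p : Pt) : ℝ :=
  (1 / 2) * ∑ c, ginv M p s c *
    (pd a (fun q => metric M q c b) p + pd b (fun q => metric M q c a) p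
      - pd c (fun q => metric M q a b) p)

/-- The covariant derivative `∇_a w_b` of a one-form. -/
def cov1 (M : ℝ) (w : Pt → Fin 4 → ℝ) (a b : Fin 4) (p : Pt) : ℝ :=
  pd a (fun q => w q b) p - ∑ s, christoffel M s a b p * w p s

/-- The covariant derivative `∇_a F_{bc}` of a covariant two-tensor. -/
def cov2 (M : ℝ) (F : Pt → Fin 4 → Fin 4 → ℝ) (a b c : Fin 4) (p : Pt) : ℝ :=
  pd a (fun q => F q b c) p - (∑ s, christoffel M s a b p * F p s c)
    - ∑ s, christoffel M s a c p * F p b s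

/-- Both indices of a covariant two-tensor raised: `F^{ab}`. -/
def raise (M : ℝ) (F : Pt → Fin 4 → Fin 4 → ℝ) (p : Pt) (a b : Fin 4) : ℝ :=
  ∑ c, ∑ d, ginv M p a c * ginv M p b d * F p c d

/-- The volume form `ε_{abcd} = √|det g| · [abcd]`, where the Levi-Civita symbol `[abcd]` is the
determinant of the matrix whose rows are the standard basis vectors of indices `a, b, c, d`. -/
def vol (M : ℝ) (p : Pt) (a b c d : Fin 4) : ℝ :=
  √|(metric M p).det| *
    ((1 : Matrix (Fin 4) (Fin 4) ℝ).submatrix ![a, b, c, d] id).det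

/-- The Hodge dual `⋆F_{ab} = ½ ε_{abcd} F^{cd}`. -/
def hodge (M : ℝ) (F : Pt → Fin 4 → Fin 4 → ℝ) (p : Pt) (a b : Fin 4) : ℝ :=
  (1 / 2) * ∑ c, ∑ d, vol M p a b c d * raise M F p c d

/-! ### The Maxwell--Born--Infeld system -/

/-- The invariant `𝐅 = ½ F_{ab} F^{ab}`. -/
def invF (M : ℝ) (F : Pt → Fin 4 → Fin 4 → ℝ) (p : Pt) : ℝ :=
  (1 / 2) * ∑ a, ∑ b, F p a b * raise M F p a b

/-- The invariant `𝐆 = ¼ F_{ab} ⋆F^{ab}`. -/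
def invG (M : ℝ) (F : Pt → Fin 4 → Fin 4 → ℝ) (p : Pt) : ℝ :=
  (1 / 4) * ∑ a, ∑ b, F p a b * raise M (hodge M F) p a b

/-- `ℓ = √(1 + 𝐅 - 𝐆²)`. -/
def ell (M : ℝ) (F : Pt → Fin 4 → Fin 4 → ℝ) (p : Pt) : ℝ :=
  √(1 + invF M F p - invG M F p ^ 2)

/-- The tensor `H_Δ^{abcd}[F]`. -/
def hDelta (M : ℝ) (F : Pt → Fin 4 → Fin 4 → ℝ) (p : Pt) (a b c d : Fin 4) : ℝ :=
  (1 / 2) *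
    (-((ell M F p ^ 2)⁻¹ * raise M F p a b * raise M F p c d)
      + invG M F p * (ell M F p ^ 2)⁻¹ *
          (raise M F p a b * raise M (hodge M F) p c d
            + raise M (hodge M F) p a b * raise M F p c d)
      - (1 + invG M F p ^ 2 * (ell M F p ^ 2)⁻¹) *
          raise M (hodge M F) p a b * raise M (hodge M F) p c d)

/-- The tensor `H^{abcd}[F] = ½ (g^{ac} g^{bd} - g^{ad} g^{bc}) + H_Δ^{abcd}[F]`. -/
def hTensor (M : ℝ) (F : Pt → Fin 4 → Fin 4 → ℝ) (p : Pt) (a b c d : Fin 4) : ℝ :=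
  (1 / 2) * (ginv M p a c * ginv M p b d - ginv M p a d * ginv M p b c) + hDelta M F p a b c d

/-- `F` is a smooth two-form on `U`. -/
structure IsSmoothTwoForm (U : Set Pt) (F : Pt → Fin 4 → Fin 4 → ℝ) : Prop where
  smooth : ∀ a b, ContDiffOn ℝ ∞ (fun p => F p a b) U
  antisymm : ∀ p ∈ U, ∀ a b, F p a b = -F p b a

/-- The two-form `F` satisfies the MBI system on `U`. The condition `1 + 𝐅 - 𝐆² > 0` says that the
Lagrangian and `ℓ⁻²` are defined; the cyclic sum is `3 ∇_{[a} F_{bc]}` for antisymmetric `F`. -/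
structure IsMBISolution (M : ℝ) (U : Set Pt) (F : Pt → Fin 4 → Fin 4 → ℝ) : Prop where
  ell_pos : ∀ p ∈ U, 0 < 1 + invF M F p - invG M F p ^ 2
  closed : ∀ p ∈ U, ∀ a b c, cov2 M F a b c p + cov2 M F b c a p + cov2 M F c a b p = 0
  field : ∀ p ∈ U, ∀ b, ∑ a, ∑ c, ∑ d, hTensor M F p a b c d * cov2 M F a c d p = 0

/-! ### Null frame, middle component and spherical Laplacian -/

/-- `L = ∂_t + ∂_{r_*}`. Since `∂_{r_*} = (1 - μ) ∂_r + μ ∂_{t*}` in the coordinates `(t*, r, ω)`,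
this is `(1 + μ) ∂_{t*} + (1 - μ) ∂_r`. -/
def vL (M : ℝ) (p : Pt) : Pt := (1 + mu M p) • dt p + (1 - mu M p) • dr p

/-- `(1 - μ)⁻¹ L̲ = ∂_{t*} - ∂_r`, which is regular across the horizon `r = 2M`. -/
def vLhat (p : Pt) : Pt := dt p - dr p

/-- `L̲ = ∂_t - ∂_{r_*} = (1 - μ) (∂_{t*} - ∂_r)`. -/
def vLbar (M : ℝ) (p : Pt) : Pt := (1 - mu M p) • vLhat p

/-- The value `F(X, Y)` of a two-form on two vectors. -/
def ev (F : Pt → Fin 4 → Fin 4 → ℝ) (p X Y : Pt) : ℝ := ∑ a, ∑ b, F p a b * X a * Y b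

/-- The middle component `ρ = ½ (1 - μ)⁻¹ F(L̲, L) = ½ F((1 - μ)⁻¹ L̲, L)`. -/
def rho (M : ℝ) (F : Pt → Fin 4 → Fin 4 → ℝ) (p : Pt) : ℝ :=
  (1 / 2) * ev F p (vLhat p) (vL M p)

/-- Away from the horizon `ρ` is literally `½ (1 - μ)⁻¹ F(L̲, L)`. -/
theorem rho_eq (M : ℝ) (F : Pt → Fin 4 → Fin 4 → ℝ) (p : Pt) (h : mu M p ≠ 1) :
    rho M F p = (1 / 2) * (1 - mu M p)⁻¹ * ev F p (vLbar M p) (vL M p) := by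
  have h1 : 1 - mu M p ≠ 0 := sub_ne_zero.mpr (Ne.symm h)
  have h2 : ev F p (vLbar M p) (vL M p) = (1 - mu M p) * ev F p (vLhat p) (vL M p) := by
    simp only [ev, vLbar, Finset.mul_sum, Pi.smul_apply, smul_eq_mul]
    refine Finset.sum_congr rfl fun a _ => Finset.sum_congr rfl fun b _ => ?_
    ring
  rw [h2, rho]
  field_simp

/-- The inverse metric `h^{ab}` induced on the spheres of constant `t*` and `r`, as a tensor on
spacetime: `h^{ab} = g^{ab} + ½ (1 - μ)⁻¹ (L^a L̲^b + L̲^a L^b)`. -/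
def hSph (M : ℝ) (p : Pt) (a b : Fin 4) : ℝ :=
  ginv M p a b + (1 / 2) * (vL M p a * vLhat p b + vLhat p a * vL M p b)

/-- The one-form `(∇̸ φ)_b = h_b^c ∂_c φ`: the differential projected on the spheres. -/
def gradSph (M : ℝ) (φ : Pt → ℝ) (p : Pt) (b : Fin 4) : ℝ :=
  ∑ c, (∑ s, metric M p b s * hSph M p s c) * pd c φ p

/-- The Laplacian `Δ̸ φ = ∇̸^A ∇̸_A φ = h^{ab} ∇_a (∇̸ φ)_b` on the spheres of constant `r`, where `∇̸`
is the Levi-Civita connection projected on these spheres. -/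
def lapSph (M : ℝ) (φ : Pt → ℝ) (p : Pt) : ℝ :=
  ∑ a, ∑ b, hSph M p a b * cov1 M (gradSph M φ) a b p

/-! ### The nonlinear terms -/

/-- The one-form `N_b = (H_Δ)^a_b^{cd} ∇_a F_{cd}`. -/
def hDeltaGrad (M : ℝ) (F : Pt → Fin 4 → Fin 4 → ℝ) (p : Pt) (b : Fin 4) : ℝ :=
  ∑ e, metric M p b e * ∑ a, ∑ c, ∑ d, hDelta M F p a e c d * cov2 M F a c d p

/-- The one-form `∇^a F_{ab}`. -/
def divF (M : ℝ) (F : Pt → Fin 4 → Fin 4 → ℝ) (p : Pt) (b : Fin 4) : ℝ :=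
  ∑ a, ∑ c, ginv M p a c * cov2 M F c a b p

/-- `NL₁ = 2 (1 - μ)/r (-N(L̲)) - 2 (1 - μ)/r N(L)`. -/
def NL1 (M : ℝ) (F : Pt → Fin 4 → Fin 4 → ℝ) (p : Pt) : ℝ :=
  2 * ((1 - mu M p) / rad p) * (-∑ b, hDeltaGrad M F p b * vLbar M p b)
    - 2 * ((1 - mu M p) / rad p) * ∑ b, hDeltaGrad M F p b * vL M p b

/-- `NL₂ = L^b L̲^a (∇_a N_b - ∇_b N_a)`. -/
def NL2 (M : ℝ) (F : Pt → Fin 4 → Fin 4 → ℝ) (p : Pt) : ℝ :=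
  ∑ b, ∑ a, vL M p b * vLbar M p a *
    (cov1 M (hDeltaGrad M F) a b p - cov1 M (hDeltaGrad M F) b a p)

end MBI

end

/-!
The mechanism is that of the Fackerell--Ipser equation for the linear Maxwell system with a source.
The first two terms of `H` turn the field equation into `N = -J`, where `J = div F`
(`hDeltaGrad_eq`), so the particular form of `H_Δ` plays no role any more, and the second formula
for `NL₂` is immediate. What remains is an identity for an arbitrary closed two-form `F` with
divergence `J`, linear in `F` (`wave_rho`).

That identity comes from five vector fields: `L`, `L̲` and the rotations `Ω₁, Ω₂, Ω₃`,
where `L` commutes with `L̲` and each `Ω_i` commutes with both. Writing the spherical divergence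
through the rotations, the null components of `J = div F` become
`r² J(L) = -L(r² ρ) + ∑ Ω_i(F(Ω_i, L))` and `r² J(L̲) = L̲(r² ρ) + ∑ Ω_i(F(Ω_i, L̲))`
(`divF_vL`, `divF_vLbar`). Apply `L̲` to the first one, `L` to the second one, and subtract. The
derivatives of `r²` are the term `NL₁`, and `L̲(J(L)) - L(J(L̲))` is `dJ(L̲, L)`, which is `NL₂` up to
sign, by `extDeriv_one`. The terms in `ρ` add up to `-2 L L̲(r² ρ)`, and closedness of `F` on the
triple `Ω_i, L̲, L` (`along_ev_rot`) turns the rest into `2 (1 - μ) ∑ Ω_i Ω_i ρ`, that is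
`2 (1 - μ) r² Δ̸ρ` (`lapSph_eq`).

The geometry enters through closed formulas in the orthogonal decomposition of `ℝ⁴` into `∂_{t*}`,
`∂_r` and the tangent spaces of the spheres (the projection `tang`): the inverse metric is
`η - μ L̂ ⊗ L̂` with `L̂ = ∂_{t*} - ∂_r` (`ginv_eq`), and the Christoffel symbols are given by
`christoffel_eq`.
-/

open scoped ContDiff

namespace MBI

section

/-! ### Calculus of partial derivatives and vector fields -/

variable {p : Pt} {φ ψ : Pt → ℝ}

theorem pd_congr (i : Fin 4) (h : φ =ᶠ[nhds p] ψ) : pd i φ p = pd i ψ p := by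
  rw [pd, pd, h.fderiv_eq]

theorem pd_const (i : Fin 4) (c : ℝ) (p : Pt) : pd i (fun _ => c) p = 0 := by
  simp [pd]

theorem pd_add (i : Fin 4) (hφ : DifferentiableAt ℝ φ p) (hψ : DifferentiableAt ℝ ψ p) :
    pd i (fun q => φ q + ψ q) p = pd i φ p + pd i ψ p := by
  simp [pd, fderiv_fun_add hφ hψ]

theorem pd_sub (i : Fin 4) (hφ : DifferentiableAt ℝ φ p) (hψ : DifferentiableAt ℝ ψ p) :
    pd i (fun q => φ q - ψ q) p = pd i φ p - pd i ψ p := by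
  simp [pd, fderiv_fun_sub hφ hψ]

theorem pd_neg (i : Fin 4) (φ : Pt → ℝ) (p : Pt) : pd i (fun q => -φ q) p = -pd i φ p := by
  simp [pd, fderiv_fun_neg]

theorem pd_mul (i : Fin 4) (hφ : DifferentiableAt ℝ φ p) (hψ : DifferentiableAt ℝ ψ p) :
    pd i (fun q => φ q * ψ q) p = pd i φ p * ψ p + φ p * pd i ψ p := by
  simp [pd, fderiv_fun_mul hφ hψ]; ring

theorem pd_sum {ι : Type*} [Fintype ι] (i : Fin 4) {f : ι → Pt → ℝ}
    (hf : ∀ k, DifferentiableAt ℝ (f k) p) :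
    pd i (fun q => ∑ k, f k q) p = ∑ k, pd i (f k) p := by
  simp [pd, fderiv_fun_sum fun k _ => hf k]

theorem pd_coord (i j : Fin 4) (p : Pt) : pd i (fun q => q j) p = if j = i then 1 else 0 := by
  have h : HasFDerivAt (fun q : Pt => q j) (ContinuousLinearMap.proj j : Pt →L[ℝ] ℝ) p :=
    hasFDerivAt_apply j p
  simp [pd, h.fderiv, Pi.single_apply]

theorem pd_smooth (i : Fin 4) (h : ContDiffAt ℝ ∞ φ p) : ContDiffAt ℝ ∞ (pd i φ) p := by
  unfold pd
  exact (h.fderiv_right (m := ∞) (by simp)).clm_apply contDiffAt_const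

/-- Partial derivatives commute. -/
theorem pd_comm (i j : Fin 4) (h : ContDiffAt ℝ ∞ φ p) :
    pd i (pd j φ) p = pd j (pd i φ) p := by
  have hd : DifferentiableAt ℝ (fderiv ℝ φ) p :=
    (h.fderiv_right (m := ∞) (by simp)).differentiableAt (by simp)
  have key : ∀ a b : Fin 4,
      pd a (pd b φ) p = fderiv ℝ (fderiv ℝ φ) p (Pi.single a 1) (Pi.single b 1) := by
    intro a b
    have : HasFDerivAt (fun q => fderiv ℝ φ q (Pi.single b 1))
        ((fderiv ℝ (fderiv ℝ φ) p).flip (Pi.single b 1)) p := by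
      simpa using hd.hasFDerivAt.clm_apply (hasFDerivAt_const (Pi.single b (1 : ℝ)) p)
    change fderiv ℝ (fun q => fderiv ℝ φ q (Pi.single b 1)) p _ = _
    rw [this.fderiv]; rfl
  rw [key, key]
  exact (h.isSymmSndFDerivAt (by simpa using WithTop.coe_le_coe.2 (le_top : (2 : ℕ∞) ≤ ⊤))).eq _ _

theorem along_congr (X : Pt → Pt) (h : φ =ᶠ[nhds p] ψ) : along X φ p = along X ψ p := by
  simp only [along, pd_congr _ h]

theorem along_const (X : Pt → Pt) (c : ℝ) (p : Pt) : along X (fun _ => c) p = 0 := by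
  simp [along, pd_const]

theorem along_add (X : Pt → Pt) (hφ : DifferentiableAt ℝ φ p) (hψ : DifferentiableAt ℝ ψ p) :
    along X (fun q => φ q + ψ q) p = along X φ p + along X ψ p := by
  simp only [along, pd_add _ hφ hψ, mul_add, Finset.sum_add_distrib]

theorem along_sub (X : Pt → Pt) (hφ : DifferentiableAt ℝ φ p) (hψ : DifferentiableAt ℝ ψ p) :
    along X (fun q => φ q - ψ q) p = along X φ p - along X ψ p := by
  simp only [along, pd_sub _ hφ hψ, mul_sub, Finset.sum_sub_distrib]

theorem along_neg (X : Pt → Pt) (φ : Pt → ℝ) (p : Pt) :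
    along X (fun q => -φ q) p = -along X φ p := by
  simp only [along, pd_neg, mul_neg, Finset.sum_neg_distrib]

theorem along_mul (X : Pt → Pt) (hφ : DifferentiableAt ℝ φ p) (hψ : DifferentiableAt ℝ ψ p) :
    along X (fun q => φ q * ψ q) p = along X φ p * ψ p + φ p * along X ψ p := by
  simp only [along, pd_mul _ hφ hψ, Finset.sum_mul, Finset.mul_sum, ← Finset.sum_add_distrib]
  exact Finset.sum_congr rfl fun _ _ => by ring

theorem along_sum {ι : Type*} [Fintype ι] (X : Pt → Pt) {f : ι → Pt → ℝ}
    (hf : ∀ k, DifferentiableAt ℝ (f k) p) :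
    along X (fun q => ∑ k, f k q) p = ∑ k, along X (f k) p := by
  simp only [along, pd_sum _ hf, Finset.mul_sum]
  exact Finset.sum_comm

/-- The vector field `X` has smooth components at `p`. -/
def SmoothField (X : Pt → Pt) (p : Pt) : Prop := ∀ i, ContDiffAt ℝ ∞ (fun q => X q i) p

/-- The Lie bracket `[X, Y]` vanishes at `p`: `X(Y^j) = Y(X^j)` for each component. -/
def LieCommute (X Y : Pt → Pt) (p : Pt) : Prop :=
  ∀ j, along X (fun q => Y q j) p = along Y (fun q => X q j) p

theorem LieCommute.symm {X Y : Pt → Pt} (h : LieCommute X Y p) : LieCommute Y X p := fun j => (h j).symm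

theorem along_smooth {X : Pt → Pt} (hX : SmoothField X p) (h : ContDiffAt ℝ ∞ φ p) :
    ContDiffAt ℝ ∞ (along X φ) p := by
  unfold along
  exact ContDiffAt.sum fun i _ => (hX i).mul (pd_smooth i h)

theorem _root_.ContDiffAt.diff (h : ContDiffAt ℝ ∞ φ p) : DifferentiableAt ℝ φ p :=
  h.differentiableAt (by simp)

/-- The second derivative along two fields, split into its first and second order parts. -/
theorem along_along (X : Pt → Pt) {Y : Pt → Pt} (hY : SmoothField Y p) (h : ContDiffAt ℝ ∞ φ p) :
    along X (along Y φ) p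
      = ∑ j, along X (fun q => Y q j) p * pd j φ p
        + ∑ i, ∑ j, X p i * Y p j * pd i (pd j φ) p := by
  have e : along X (along Y φ) p = ∑ j, along X (fun q => Y q j * pd j φ q) p :=
    along_sum X fun j => ((hY j).mul (pd_smooth j h)).diff
  rw [e, Finset.sum_comm (f := fun i j => X p i * Y p j * pd i (pd j φ) p),
    ← Finset.sum_add_distrib]
  refine Finset.sum_congr rfl fun j _ => ?_
  rw [along_mul X (hY j).diff (pd_smooth j h).diff]
  congr 1
  rw [along, Finset.mul_sum]
  exact Finset.sum_congr rfl fun i _ => by ring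

theorem along_comm {X Y : Pt → Pt} (hX : SmoothField X p) (hY : SmoothField Y p)
    (h : ContDiffAt ℝ ∞ φ p) (hXY : LieCommute X Y p) :
    along X (along Y φ) p = along Y (along X φ) p := by
  rw [along_along X hY h, along_along Y hX h]
  congr 1
  · exact Finset.sum_congr rfl fun j _ => by rw [hXY j]
  · rw [Finset.sum_comm]
    refine Finset.sum_congr rfl fun i _ => Finset.sum_congr rfl fun j _ => ?_
    rw [pd_comm j i h]; ring

/-- The exterior derivative of a one-form on two commuting vector fields. -/
theorem extDeriv_one {w : Pt → Fin 4 → ℝ} {X Y : Pt → Pt}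
    (hw : ∀ b, DifferentiableAt ℝ (fun q => w q b) p)
    (hX : SmoothField X p) (hY : SmoothField Y p) (hXY : LieCommute X Y p) :
    ∑ b, ∑ a, Y p b * X p a * (pd a (fun q => w q b) p - pd b (fun q => w q a) p)
      = along X (fun q => ∑ b, w q b * Y q b) p - along Y (fun q => ∑ b, w q b * X q b) p := by
  rw [along_sum X fun b => (hw b).fun_mul (hY b).diff, along_sum Y fun b => (hw b).fun_mul (hX b).diff]
  simp only [along_mul _ (hw _) (hY _).diff, along_mul _ (hw _) (hX _).diff, hXY _,
    Finset.sum_add_distrib, add_sub_add_right_eq_sub, mul_sub, Finset.sum_sub_distrib]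
  congr 1
  · refine Finset.sum_congr rfl fun b _ => ?_
    rw [along, Finset.sum_mul]
    exact Finset.sum_congr rfl fun a _ => by ring
  · rw [Finset.sum_comm]
    refine Finset.sum_congr rfl fun b _ => ?_
    rw [along, Finset.sum_mul]
    exact Finset.sum_congr rfl fun a _ => by ring

theorem along_ev {F : Pt → Fin 4 → Fin 4 → ℝ} (X : Pt → Pt) {Y Z : Pt → Pt}
    (hF : ∀ a b, ContDiffAt ℝ ∞ (fun q => F q a b) p)
    (hY : SmoothField Y p) (hZ : SmoothField Z p) :
    along X (fun q => ev F q (Y q) (Z q)) p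
      = ∑ a, ∑ b, along X (fun q => F q a b) p * Y p a * Z p b
        + ev F p (fun a => along X (fun q => Y q a) p) (Z p)
        + ev F p (Y p) (fun b => along X (fun q => Z q b) p) := by
  simp only [ev]
  rw [along_sum X fun a => (ContDiffAt.sum fun b _ =>
    ((hF a b).mul (hY a)).mul (hZ b)).diff, ← Finset.sum_add_distrib, ← Finset.sum_add_distrib]
  refine Finset.sum_congr rfl fun a _ => ?_
  rw [along_sum X fun b => (((hF a b).mul (hY a)).mul (hZ b)).diff, ← Finset.sum_add_distrib,
    ← Finset.sum_add_distrib]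
  refine Finset.sum_congr rfl fun b _ => ?_
  rw [along_mul X ((hF a b).mul (hY a)).diff (hZ b).diff, along_mul X (hF a b).diff (hY a).diff]
  ring

theorem ev_smooth {F : Pt → Fin 4 → Fin 4 → ℝ} {Y Z : Pt → Pt}
    (hF : ∀ a b, ContDiffAt ℝ ∞ (fun q => F q a b) p)
    (hY : SmoothField Y p) (hZ : SmoothField Z p) :
    ContDiffAt ℝ ∞ (fun q => ev F q (Y q) (Z q)) p := by
  unfold ev
  exact ContDiffAt.sum fun a _ => ContDiffAt.sum fun b _ => ((hF a b).mul (hY a)).mul (hZ b)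

theorem ev_antisymm {F : Pt → Fin 4 → Fin 4 → ℝ} (hA : ∀ a b, F p a b = -F p b a) (Y Z : Pt) :
    ev F p Y Z = -ev F p Z Y := by
  simp only [ev]
  rw [Finset.sum_comm, ← Finset.sum_neg_distrib]
  refine Finset.sum_congr rfl fun a _ => ?_
  rw [← Finset.sum_neg_distrib]
  exact Finset.sum_congr rfl fun b _ => by rw [hA b a]; ring

/-- `dF = 0` evaluated on three commuting vector fields. -/
theorem extDeriv_two {F : Pt → Fin 4 → Fin 4 → ℝ} {X Y Z : Pt → Pt}
    (hF : ∀ a b, ContDiffAt ℝ ∞ (fun q => F q a b) p) (hA : ∀ a b, F p a b = -F p b a)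
    (hdF : ∀ a b c, pd a (fun q => F q b c) p + pd b (fun q => F q c a) p
      + pd c (fun q => F q a b) p = 0)
    (hX : SmoothField X p) (hY : SmoothField Y p) (hZ : SmoothField Z p)
    (hXY : LieCommute X Y p) (hYZ : LieCommute Y Z p) (hZX : LieCommute Z X p) :
    along X (fun q => ev F q (Y q) (Z q)) p + along Y (fun q => ev F q (Z q) (X q)) p
      + along Z (fun q => ev F q (X q) (Y q)) p = 0 := by
  rw [along_ev X hF hY hZ, along_ev Y hF hZ hX, along_ev Z hF hX hY]
  simp only [hXY _, hYZ _, hZX _]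
  rw [ev_antisymm hA (fun a => along Y (fun q => X q a) p) (Z p),
    ev_antisymm hA (fun a => along Z (fun q => Y q a) p) (X p),
    ev_antisymm hA (fun a => along X (fun q => Z q a) p) (Y p)]
  have key : ∑ a, ∑ b, ∑ c, X p a * Y p b * Z p c * (pd a (fun q => F q b c) p
      + pd b (fun q => F q c a) p + pd c (fun q => F q a b) p) = 0 := by
    simp only [hdF, mul_zero, Finset.sum_const_zero]
  simp only [mul_add, Finset.sum_add_distrib] at key
  have e1 : ∑ a, ∑ b, ∑ c, X p a * Y p b * Z p c * pd a (fun q => F q b c) p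
      = ∑ b, ∑ c, along X (fun q => F q b c) p * Y p b * Z p c := by
    rw [Finset.sum_comm]
    refine Finset.sum_congr rfl fun b _ => ?_
    rw [Finset.sum_comm]
    refine Finset.sum_congr rfl fun c _ => ?_
    simp only [along, Finset.sum_mul]
    exact Finset.sum_congr rfl fun a _ => by ring
  have e2 : ∑ a, ∑ b, ∑ c, X p a * Y p b * Z p c * pd b (fun q => F q c a) p
      = ∑ c, ∑ a, along Y (fun q => F q c a) p * Z p c * X p a := by
    rw [Finset.sum_comm (f := fun c a => along Y (fun q => F q c a) p * Z p c * X p a)]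
    refine Finset.sum_congr rfl fun a _ => ?_
    rw [Finset.sum_comm]
    refine Finset.sum_congr rfl fun c _ => ?_
    simp only [along, Finset.sum_mul]
    exact Finset.sum_congr rfl fun b _ => by ring
  have e3 : ∑ a, ∑ b, ∑ c, X p a * Y p b * Z p c * pd c (fun q => F q a b) p
      = ∑ a, ∑ b, along Z (fun q => F q a b) p * X p a * Y p b := by
    refine Finset.sum_congr rfl fun a _ => Finset.sum_congr rfl fun b _ => ?_
    simp only [along, Finset.sum_mul]
    exact Finset.sum_congr rfl fun c _ => by ring
  rw [e1, e2, e3] at key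
  linarith

end

section

/-! ### The Schwarzschild geometry in the chart -/

variable {M : ℝ} {p : Pt}

theorem isOpen_spacetime : IsOpen spacetime :=
  isOpen_lt continuous_const (by unfold rad; fun_prop)

theorem rad_sq (p : Pt) : rad p ^ 2 = p 1 ^ 2 + p 2 ^ 2 + p 3 ^ 2 :=
  Real.sq_sqrt (by positivity)

theorem rad_smooth (hp : p ∈ spacetime) : ContDiffAt ℝ ∞ rad p := by
  have h : p 1 ^ 2 + p 2 ^ 2 + p 3 ^ 2 ≠ 0 := by
    rw [← rad_sq]; exact pow_ne_zero 2 (ne_of_gt hp)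
  exact ContDiffAt.sqrt (by fun_prop) h

theorem dr_zero (p : Pt) : dr p 0 = 0 := rfl

theorem dtdr_eq (p : Pt) (a : Fin 4) : dtdr p a = dt p a + dr p a := by
  fin_cases a <;> simp [dtdr, dt, dr]

theorem dr_sq (hp : p ∈ spacetime) : dr p 1 ^ 2 + dr p 2 ^ 2 + dr p 3 ^ 2 = 1 := by
  have h : rad p ≠ 0 := ne_of_gt hp
  simp only [dr, Matrix.cons_val]
  field_simp
  exact (rad_sq p).symm

theorem dr_mul_rad (hp : p ∈ spacetime) (a : Fin 4) :
    dr p a * rad p = Matrix.diagonal ![(0 : ℝ), 1, 1, 1] a a * p a := by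
  have h : rad p ≠ 0 := ne_of_gt hp
  fin_cases a <;> simp [dr, h]

theorem dr_smooth (hp : p ∈ spacetime) : SmoothField dr p := by
  have h : rad p ≠ 0 := ne_of_gt hp
  have key : ∀ j : Fin 4, ContDiffAt ℝ ∞ (fun q : Pt => q j / rad q) p := fun j =>
    ContDiffAt.div (by fun_prop) (rad_smooth hp) h
  intro i
  fin_cases i
  · exact contDiffAt_const
  · exact key 1
  · exact key 2
  · exact key 3

theorem dt_smooth (p : Pt) : SmoothField dt p := fun _ => contDiffAt_const

theorem mu_smooth (M : ℝ) (hp : p ∈ spacetime) : ContDiffAt ℝ ∞ (mu M) p :=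
  ContDiffAt.div contDiffAt_const (rad_smooth hp) (ne_of_gt hp)

theorem vLhat_smooth (hp : p ∈ spacetime) : SmoothField vLhat p := fun i =>
  (dt_smooth p i).sub (dr_smooth hp i)

theorem vL_smooth (M : ℝ) (hp : p ∈ spacetime) : SmoothField (vL M) p := fun i =>
  ((contDiffAt_const.add (mu_smooth M hp)).mul (dt_smooth p i)).add
    ((contDiffAt_const.sub (mu_smooth M hp)).mul (dr_smooth hp i))

theorem vLbar_smooth (M : ℝ) (hp : p ∈ spacetime) : SmoothField (vLbar M) p := fun i =>
  (contDiffAt_const.sub (mu_smooth M hp)).mul (vLhat_smooth hp i)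

theorem dtdr_smooth (hp : p ∈ spacetime) : SmoothField dtdr p := fun i => by
  simp only [dtdr_eq]
  exact (dt_smooth p i).add (dr_smooth hp i)

/-- The Euclidean orthogonal projection of `ℝ × ℝ³` onto the tangent spaces of the spheres of
constant `t*` and `r`. -/
noncomputable def tang (p : Pt) (a b : Fin 4) : ℝ :=
  Matrix.diagonal ![(0 : ℝ), 1, 1, 1] a b - dr p a * dr p b

theorem tang_symm (p : Pt) (a b : Fin 4) : tang p a b = tang p b a := by
  fin_cases a <;> fin_cases b <;> simp [tang, mul_comm]

theorem tang_smooth (hp : p ∈ spacetime) (a b : Fin 4) :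
    ContDiffAt ℝ ∞ (fun q => tang q a b) p :=
  contDiffAt_const.sub ((dr_smooth hp a).mul (dr_smooth hp b))

theorem pd_rad (hp : p ∈ spacetime) (a : Fin 4) : pd a rad p = dr p a := by
  have h : rad p ≠ 0 := ne_of_gt hp
  have hd := (rad_smooth hp).diff
  have hc : ∀ j : Fin 4, DifferentiableAt ℝ (fun q : Pt => q j) p := fun j => by fun_prop
  have e : pd a (fun q => rad q * rad q) p
      = pd a (fun q => q 1 * q 1 + q 2 * q 2 + q 3 * q 3) p := by
    congr 1; funext q; linear_combination rad_sq q
  rw [pd_mul a hd hd, pd_add a (((hc 1).fun_mul (hc 1)).fun_add ((hc 2).fun_mul (hc 2)))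
    ((hc 3).fun_mul (hc 3)), pd_add a ((hc 1).fun_mul (hc 1)) ((hc 2).fun_mul (hc 2)),
    pd_mul a (hc 1) (hc 1), pd_mul a (hc 2) (hc 2), pd_mul a (hc 3) (hc 3)] at e
  simp only [pd_coord] at e
  have e2 : pd a rad p * rad p = dr p a * rad p := by
    rw [dr_mul_rad hp]
    fin_cases a
    · simp at e ⊢
      left
      by_contra h0
      apply mul_ne_zero h0 h
      linarith
    all_goals simp at e ⊢; linarith
  exact mul_right_cancel₀ h e2

theorem pd_dr (hp : p ∈ spacetime) (a b : Fin 4) :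
    pd a (fun q => dr q b) p = tang p a b / rad p := by
  have h : rad p ≠ 0 := ne_of_gt hp
  have e : pd a (fun q => dr q b * rad q) p
      = pd a (fun q => Matrix.diagonal ![(0 : ℝ), 1, 1, 1] b b * q b) p :=
    pd_congr a (Filter.eventually_of_mem (isOpen_spacetime.mem_nhds hp) fun q hq =>
      dr_mul_rad hq b)
  rw [pd_mul a (dr_smooth hp b).diff (rad_smooth hp).diff, pd_rad hp,
    pd_mul a (differentiableAt_const _) (by fun_prop), pd_const, pd_coord] at e
  rw [eq_div_iff h]
  simp only [tang]
  have : Matrix.diagonal ![(0 : ℝ), 1, 1, 1] a b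
      = Matrix.diagonal ![(0 : ℝ), 1, 1, 1] b b * if b = a then 1 else 0 := by
    fin_cases a <;> fin_cases b <;> simp
  rw [this]
  linear_combination e

theorem pd_mu (M : ℝ) (hp : p ∈ spacetime) (a : Fin 4) :
    pd a (mu M) p = -(mu M p / rad p * dr p a) := by
  have h : rad p ≠ 0 := ne_of_gt hp
  have e : pd a (fun q => mu M q * rad q) p = pd a (fun _ => 2 * M) p :=
    pd_congr a (Filter.eventually_of_mem (isOpen_spacetime.mem_nhds hp) fun q hq =>
      div_mul_cancel₀ _ (ne_of_gt hq))
  rw [pd_mul a (mu_smooth M hp).diff (rad_smooth hp).diff, pd_rad hp, pd_const] at e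
  field_simp
  linarith

theorem pd_dtdr (hp : p ∈ spacetime) (a b : Fin 4) :
    pd a (fun q => dtdr q b) p = tang p a b / rad p := by
  simp only [dtdr_eq]
  rw [pd_add a (dt_smooth p b).diff (dr_smooth hp b).diff, pd_dr hp]
  simp [dt, pd_const]

theorem pd_vLhat (hp : p ∈ spacetime) (a b : Fin 4) :
    pd a (fun q => vLhat q b) p = -(tang p a b / rad p) := by
  simp only [vLhat, Pi.sub_apply]
  rw [pd_sub a (dt_smooth p b).diff (dr_smooth hp b).diff, pd_dr hp]
  simp [dt, pd_const]

theorem vL_apply (M : ℝ) (p : Pt) (a : Fin 4) :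
    vL M p a = (1 + mu M p) * dt p a + (1 - mu M p) * dr p a := rfl

theorem vLhat_apply (p : Pt) (a : Fin 4) : vLhat p a = dt p a - dr p a := rfl

theorem vLbar_apply (M : ℝ) (p : Pt) (a : Fin 4) :
    vLbar M p a = (1 - mu M p) * vLhat p a := rfl

/-- The Killing field `∂_t` is `½ (L + L̲)`. -/
theorem vLbar_eq (M : ℝ) (p : Pt) (a : Fin 4) : vLbar M p a = 2 * dt p a - vL M p a := by
  rw [vLbar_apply, vLhat_apply, vL_apply]; ring

/-- The derivative of `L = (∂_{t*} + ∂_r) + μ L̂`. -/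
theorem pd_vL (M : ℝ) (hp : p ∈ spacetime) (a b : Fin 4) :
    pd a (fun q => vL M q b) p
      = -(mu M p / rad p * dr p a * vLhat p b) + (1 - mu M p) / rad p * tang p a b := by
  have e : (fun q => vL M q b) = fun q => (dt p b + dr q b) + mu M q * vLhat q b := by
    funext q; rw [vL_apply, vLhat_apply]; simp only [dt]; ring
  rw [e, pd_add a (contDiffAt_const.add (dr_smooth hp b)).diff
    ((mu_smooth M hp).mul (vLhat_smooth hp b)).diff, pd_add a (differentiableAt_const _)
    (dr_smooth hp b).diff, pd_const, pd_dr hp, pd_mul a (mu_smooth M hp).diff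
    (vLhat_smooth hp b).diff, pd_mu M hp, pd_vLhat hp]
  ring

theorem pd_vLbar (M : ℝ) (hp : p ∈ spacetime) (a b : Fin 4) :
    pd a (fun q => vLbar M q b) p = -pd a (fun q => vL M q b) p := by
  simp only [vLbar_eq]
  rw [pd_sub a (((dt_smooth p b).diff).const_mul 2) (vL_smooth M hp b).diff]
  simp [dt, pd_const]

/-! ### Contractions of the frame -/

theorem sum_dr_mul_dr (hp : p ∈ spacetime) : ∑ a, dr p a * dr p a = 1 := by
  rw [← dr_sq hp]; simp only [Fin.sum_univ_four, dr_zero]; ring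

theorem sum_dt_mul_dr (p : Pt) : ∑ a, dt p a * dr p a = 0 := by
  simp [Fin.sum_univ_four, dt, dr]

theorem sum_dt_mul_dt (p : Pt) : ∑ a, dt p a * dt p a = 1 := by
  simp [Fin.sum_univ_four, dt]

theorem sum_dr_mul_tang (hp : p ∈ spacetime) (b : Fin 4) : ∑ a, dr p a * tang p a b = 0 := by
  have h := dr_sq hp
  fin_cases b <;> simp [Fin.sum_univ_four, tang, dr_zero] <;> grind

theorem sum_dt_mul_tang (p : Pt) (b : Fin 4) : ∑ a, dt p a * tang p a b = 0 := by
  fin_cases b <;> simp [Fin.sum_univ_four, tang, dt, dr_zero]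

/-- The projection `tang` is idempotent. -/
theorem sum_tang_mul_tang (hp : p ∈ spacetime) (a b : Fin 4) :
    ∑ c, tang p a c * tang p c b = tang p a b := by
  have h := dr_sq hp
  fin_cases a <;> fin_cases b <;> simp [Fin.sum_univ_four, tang, dr_zero] <;> grind

theorem sum_tang_diag (hp : p ∈ spacetime) : ∑ a, tang p a a = 2 := by
  have h := dr_sq hp
  simp [Fin.sum_univ_four, tang, dr_zero]; grind

/-! ### Metric and Christoffel symbols -/

/-- The Minkowski metric in the orthogonal decomposition of `ℝ⁴`. -/
theorem minkowski_eq (p : Pt) (a b : Fin 4) :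
    Matrix.diagonal ![(-1 : ℝ), 1, 1, 1] a b
      = tang p a b + dr p a * dr p b - dt p a * dt p b := by
  fin_cases a <;> fin_cases b <;> simp [tang, dt]

/-- The identity matrix in the orthogonal decomposition of `ℝ⁴`. -/
theorem one_eq (p : Pt) (a b : Fin 4) :
    (1 : Matrix (Fin 4) (Fin 4) ℝ) a b = tang p a b + dr p a * dr p b + dt p a * dt p b := by
  fin_cases a <;> fin_cases b <;> simp [tang, dt]

theorem metric_eq (M : ℝ) (p : Pt) (a b : Fin 4) :
    metric M p a b = tang p a b + dr p a * dr p b - dt p a * dt p b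
      + mu M p * dtdr p a * dtdr p b := by
  rw [← minkowski_eq]; rfl

theorem metric_symm (M : ℝ) (p : Pt) (a b : Fin 4) : metric M p a b = metric M p b a := by
  rw [metric_eq, metric_eq, tang_symm]; ring

theorem metric_mul_eq_one (M : ℝ) (hp : p ∈ spacetime) :
    metric M p * Matrix.of (fun a b => tang p a b + dr p a * dr p b - dt p a * dt p b
      - mu M p * vLhat p a * vLhat p b) = 1 := by
  ext a b
  rw [Matrix.mul_apply, one_eq p]
  simp only [metric_eq, Matrix.of_apply, dtdr_eq, vLhat_apply]
  have h1 := sum_dr_mul_dr hp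
  have h2 := sum_dt_mul_dr p
  have h3 := sum_dt_mul_dt p
  have h4 := sum_dr_mul_tang hp b
  have h5 := sum_dt_mul_tang p b
  have h4' := sum_dr_mul_tang hp a
  have h5' := sum_dt_mul_tang p a
  have h6 := sum_tang_mul_tang hp a b
  simp only [tang_symm p _ a] at h4' h5'
  simp only [Fin.sum_univ_four] at *
  linear_combination h6 + (dr p b + mu M p * (dt p b - dr p b)) * h4'
    - (dt p b + mu M p * (dt p b - dr p b)) * h5'
    + (dr p a + mu M p * (dt p a + dr p a)) * h4
    + (-dt p a + mu M p * (dt p a + dr p a)) * h5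
    + (dr p a + mu M p * (dt p a + dr p a)) * (dr p b + mu M p * (dt p b - dr p b)) * h1
    + ((-dt p a + mu M p * (dt p a + dr p a)) * (dr p b + mu M p * (dt p b - dr p b))
      - (dr p a + mu M p * (dt p a + dr p a)) * (dt p b + mu M p * (dt p b - dr p b))) * h2
    - (-dt p a + mu M p * (dt p a + dr p a)) * (dt p b + mu M p * (dt p b - dr p b)) * h3

/-- The inverse metric is `η^{ab} - μ L̂^a L̂^b`, where `L̂ = ∂_{t*} - ∂_r`. -/
theorem ginv_eq (M : ℝ) (hp : p ∈ spacetime) (a b : Fin 4) :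
    ginv M p a b = tang p a b + dr p a * dr p b - dt p a * dt p b
      - mu M p * vLhat p a * vLhat p b := by
  rw [ginv, Matrix.inv_eq_right_inv (metric_mul_eq_one M hp)]; rfl

theorem metric_mul_ginv (M : ℝ) (hp : p ∈ spacetime) : metric M p * ginv M p = 1 := by
  rw [ginv, Matrix.inv_eq_right_inv (metric_mul_eq_one M hp), metric_mul_eq_one M hp]

theorem ginv_symm (M : ℝ) (hp : p ∈ spacetime) (a b : Fin 4) : ginv M p a b = ginv M p b a := by
  rw [ginv_eq M hp, ginv_eq M hp, tang_symm]; ring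

theorem metric_smooth (M : ℝ) (hp : p ∈ spacetime) (a b : Fin 4) :
    ContDiffAt ℝ ∞ (fun q => metric M q a b) p :=
  contDiffAt_const.add (((mu_smooth M hp).mul (dtdr_smooth hp a)).mul (dtdr_smooth hp b))

theorem ginv_smooth (M : ℝ) (hp : p ∈ spacetime) (a b : Fin 4) :
    ContDiffAt ℝ ∞ (fun q => ginv M q a b) p := by
  have h : ContDiffAt ℝ ∞ (fun q => tang q a b + dr q a * dr q b - dt q a * dt q b
      - mu M q * vLhat q a * vLhat q b) p :=
    (((tang_smooth hp a b).add ((dr_smooth hp a).mul (dr_smooth hp b))).sub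
      ((dt_smooth p a).mul (dt_smooth p b))).sub
      (((mu_smooth M hp).mul (vLhat_smooth hp a)).mul (vLhat_smooth hp b))
  exact h.congr_of_eventuallyEq (Filter.eventually_of_mem (isOpen_spacetime.mem_nhds hp)
    fun q hq => ginv_eq M hq a b)

theorem pd_metric (M : ℝ) (hp : p ∈ spacetime) (c a b : Fin 4) :
    pd c (fun q => metric M q a b) p
      = mu M p / rad p * (-(dr p c * dtdr p a * dtdr p b) + tang p c a * dtdr p b
        + dtdr p a * tang p c b) := by
  have e : (fun q => metric M q a b) = fun q =>
      Matrix.diagonal ![(-1 : ℝ), 1, 1, 1] a b + mu M q * dtdr q a * dtdr q b := rfl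
  have h1 := (mu_smooth M hp).mul (dtdr_smooth hp a)
  rw [e, pd_add c (differentiableAt_const _) (h1.mul (dtdr_smooth hp b)).diff, pd_const,
    pd_mul c h1.diff (dtdr_smooth hp b).diff, pd_mul c (mu_smooth M hp).diff
    (dtdr_smooth hp a).diff, pd_mu M hp, pd_dtdr hp, pd_dtdr hp]
  ring

theorem christoffel_symm (M : ℝ) (s a b : Fin 4) (p : Pt) :
    christoffel M s a b p = christoffel M s b a p := by
  simp only [christoffel, metric_symm M _ a b]
  congr 1
  exact Finset.sum_congr rfl fun c _ => by ring

theorem sum_ginv_mul_dtdr (M : ℝ) (hp : p ∈ spacetime) (a : Fin 4) :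
    ∑ c, ginv M p a c * dtdr p c = -vLhat p a := by
  have h1 := sum_dr_mul_dr hp
  have h2 := sum_dt_mul_dr p
  have h3 := sum_dt_mul_dt p
  have h4 := sum_dr_mul_tang hp a
  have h5 := sum_dt_mul_tang p a
  simp only [tang_symm p _ a] at h4 h5
  simp only [Fin.sum_univ_four, ginv_eq M hp, dtdr_eq, vLhat_apply] at *
  linear_combination h4 + h5 + (dr p a + mu M p * (dt p a - dr p a)) * (h1 + h2)
    - (dt p a + mu M p * (dt p a - dr p a)) * (h2 + h3)

theorem sum_ginv_mul_dr (M : ℝ) (hp : p ∈ spacetime) (a : Fin 4) :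
    ∑ c, ginv M p a c * dr p c = dr p a + mu M p * vLhat p a := by
  have h1 := sum_dr_mul_dr hp
  have h2 := sum_dt_mul_dr p
  have h4 := sum_dr_mul_tang hp a
  simp only [tang_symm p _ a] at h4
  simp only [Fin.sum_univ_four, ginv_eq M hp, vLhat_apply] at *
  linear_combination h4 + (dr p a + mu M p * (dt p a - dr p a)) * h1
    - (dt p a + mu M p * (dt p a - dr p a)) * h2

theorem sum_ginv_mul_tang (M : ℝ) (hp : p ∈ spacetime) (a b : Fin 4) :
    ∑ c, ginv M p a c * tang p c b = tang p a b := by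
  have h4 := sum_dr_mul_tang hp b
  have h5 := sum_dt_mul_tang p b
  have h6 := sum_tang_mul_tang hp a b
  simp only [Fin.sum_univ_four, ginv_eq M hp, vLhat_apply] at *
  linear_combination h6 + (dr p a + mu M p * (dt p a - dr p a)) * h4
    - (dt p a + mu M p * (dt p a - dr p a)) * h5

/-- The Christoffel symbols of the Schwarzschild metric in closed form. -/
theorem christoffel_eq (M : ℝ) (hp : p ∈ spacetime) (s a b : Fin 4) :
    christoffel M s a b p = mu M p / rad p * (-(vLhat p s * tang p a b)
      + (1 / 2) * ((dr p s + mu M p * vLhat p s) * dtdr p a * dtdr p b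
        + vLhat p s * (dr p a * dtdr p b + dr p b * dtdr p a))) := by
  have h1 := sum_ginv_mul_dtdr M hp s
  have h2 := sum_ginv_mul_dr M hp s
  have e : ∀ c, pd a (fun q => metric M q c b) p + pd b (fun q => metric M q c a) p
      - pd c (fun q => metric M q a b) p = mu M p / rad p * ((2 * tang p a b
        - dr p a * dtdr p b - dr p b * dtdr p a) * dtdr p c
        + dtdr p a * dtdr p b * dr p c) := by
    intro c
    rw [pd_metric M hp, pd_metric M hp, pd_metric M hp, tang_symm p c a, tang_symm p c b,
      tang_symm p b a]
    ring
  simp only [christoffel, e]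
  simp only [Fin.sum_univ_four] at *
  linear_combination (mu M p / rad p / 2) * (2 * tang p a b
        - dr p a * dtdr p b - dr p b * dtdr p a) * h1
      + (mu M p / rad p / 2) * dtdr p a * dtdr p b * h2

end

section

variable {M : ℝ} {p : Pt} {φ : Pt → ℝ}

/-! ### Rotations -/

/-- The rotation fields `Ω_i = x × ∇`, which are Killing and commute with `L` and `L̲`. -/
def rot (i : Fin 3) (p : Pt) : Pt :=
  ![![0, 0, -p 3, p 2], ![0, p 3, 0, -p 1], ![0, -p 2, p 1, 0]] i

theorem rot_smooth (i : Fin 3) (p : Pt) : SmoothField (rot i) p := by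
  intro a
  fin_cases i <;> fin_cases a <;> simp [rot] <;> fun_prop

theorem pd_rot (c : Fin 4) (i : Fin 3) (a : Fin 4) (p : Pt) :
    pd c (fun q => rot i q a) p = rot i (Pi.single c 1) a := by
  fin_cases i <;> fin_cases a <;> fin_cases c <;>
    simp [rot, pd_coord, pd_neg, pd_const]

theorem along_rot_field (X : Pt → Pt) (i : Fin 3) (a : Fin 4) (p : Pt) :
    along X (fun q => rot i q a) p = rot i (X p) a := by
  simp only [along, pd_rot]
  fin_cases i <;> fin_cases a <;> simp [rot, Pi.single_apply]

theorem sum_rot_mul_rot (hp : p ∈ spacetime) (a b : Fin 4) :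
    ∑ i, rot i p a * rot i p b = rad p ^ 2 * tang p a b := by
  have h : rad p ≠ 0 := ne_of_gt hp
  have h2 := rad_sq p
  fin_cases a <;> fin_cases b <;> simp [Fin.sum_univ_three, rot, tang, dr] <;> field_simp <;>
    rw [h2] <;> ring

theorem sum_rot_rot (hp : p ∈ spacetime) (a : Fin 4) :
    ∑ i, rot i (rot i p) a = -2 * rad p * dr p a := by
  have h : rad p ≠ 0 := ne_of_gt hp
  fin_cases a <;> simp [Fin.sum_univ_three, rot, dr] <;> field_simp <;> ring

theorem sum_rot_mul_dr (i : Fin 3) (p : Pt) : ∑ a, rot i p a * dr p a = 0 := by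
  fin_cases i <;> simp [Fin.sum_univ_four, rot, dr] <;> ring

theorem sum_rot_mul_tang (i : Fin 3) (p : Pt) (b : Fin 4) :
    ∑ a, rot i p a * tang p a b = rot i p b := by
  fin_cases i <;> fin_cases b <;> simp [Fin.sum_univ_four, rot, dr, tang] <;> ring

/-! ### Derivatives along the frame -/

theorem along_rad (X : Pt → Pt) (hp : p ∈ spacetime) : along X rad p = ∑ a, X p a * dr p a := by
  simp only [along, pd_rad hp]

theorem along_mu (M : ℝ) (X : Pt → Pt) (hp : p ∈ spacetime) :
    along X (mu M) p = -(mu M p / rad p) * ∑ a, X p a * dr p a := by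
  simp only [along, pd_mu M hp, Finset.mul_sum]
  exact Finset.sum_congr rfl fun a _ => by ring

theorem along_rot_mu (M : ℝ) (i : Fin 3) (hp : p ∈ spacetime) :
    along (rot i) (fun q => 2 * (1 - mu M q)) p = 0 := by
  have hm := mu_smooth M hp
  rw [along_mul _ (differentiableAt_const _) (contDiffAt_const.sub hm).diff, along_const,
    along_sub _ (differentiableAt_const _) hm.diff, along_const, along_mu M _ hp, sum_rot_mul_dr]
  ring

theorem along_vL_field (M : ℝ) (X : Pt → Pt) (hp : p ∈ spacetime) (b : Fin 4) :
    along X (fun q => vL M q b) p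
      = -(mu M p / rad p * vLhat p b) * (∑ a, X p a * dr p a)
        + (1 - mu M p) / rad p * ∑ a, X p a * tang p a b := by
  simp only [along, pd_vL M hp, Finset.mul_sum, ← Finset.sum_add_distrib]
  exact Finset.sum_congr rfl fun a _ => by ring

theorem along_vLbar_field (M : ℝ) (X : Pt → Pt) (hp : p ∈ spacetime) (b : Fin 4) :
    along X (fun q => vLbar M q b) p = -along X (fun q => vL M q b) p := by
  simp only [along, pd_vLbar M hp, mul_neg, Finset.sum_neg_distrib]

theorem along_vLhat_field (X : Pt → Pt) (hp : p ∈ spacetime) (b : Fin 4) :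
    along X (fun q => vLhat q b) p = -(∑ a, X p a * tang p a b) / rad p := by
  simp only [along, pd_vLhat hp, neg_div, Finset.sum_div, ← Finset.sum_neg_distrib]
  exact Finset.sum_congr rfl fun a _ => by ring

theorem sum_vL_mul_dr (M : ℝ) (hp : p ∈ spacetime) : ∑ a, vL M p a * dr p a = 1 - mu M p := by
  have h1 := sum_dr_mul_dr hp
  have h2 := sum_dt_mul_dr p
  simp only [Fin.sum_univ_four, vL_apply] at *
  linear_combination (1 - mu M p) * h1 + (1 + mu M p) * h2

theorem sum_vLhat_mul_dr (hp : p ∈ spacetime) : ∑ a, vLhat p a * dr p a = -1 := by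
  have h1 := sum_dr_mul_dr hp
  have h2 := sum_dt_mul_dr p
  simp only [Fin.sum_univ_four, vLhat_apply] at *
  linear_combination h2 - h1

theorem sum_vLbar_mul_dr (M : ℝ) (hp : p ∈ spacetime) :
    ∑ a, vLbar M p a * dr p a = -(1 - mu M p) := by
  simp only [vLbar_apply, mul_assoc, ← Finset.mul_sum, sum_vLhat_mul_dr hp]
  ring

theorem sum_vL_mul_tang (M : ℝ) (hp : p ∈ spacetime) (b : Fin 4) :
    ∑ a, vL M p a * tang p a b = 0 := by
  have h1 := sum_dr_mul_tang hp b
  have h2 := sum_dt_mul_tang p b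
  simp only [Fin.sum_univ_four, vL_apply] at *
  linear_combination (1 - mu M p) * h1 + (1 + mu M p) * h2

theorem sum_vLhat_mul_tang (hp : p ∈ spacetime) (b : Fin 4) :
    ∑ a, vLhat p a * tang p a b = 0 := by
  have h1 := sum_dr_mul_tang hp b
  have h2 := sum_dt_mul_tang p b
  simp only [Fin.sum_univ_four, vLhat_apply] at *
  linear_combination h2 - h1

theorem sum_vLbar_mul_tang (M : ℝ) (hp : p ∈ spacetime) (b : Fin 4) :
    ∑ a, vLbar M p a * tang p a b = 0 := by
  simp only [vLbar_apply, mul_assoc, ← Finset.mul_sum, sum_vLhat_mul_tang hp, mul_zero]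

theorem sum_dtdr_mul_vL (M : ℝ) (hp : p ∈ spacetime) : ∑ a, dtdr p a * vL M p a = 2 := by
  have h1 := sum_dr_mul_dr hp
  have h2 := sum_dt_mul_dr p
  have h3 := sum_dt_mul_dt p
  simp only [Fin.sum_univ_four, vL_apply, dtdr_eq] at *
  linear_combination (1 - mu M p) * h1 + 2 * h2 + (1 + mu M p) * h3

theorem sum_dtdr_mul_vLhat (hp : p ∈ spacetime) : ∑ a, dtdr p a * vLhat p a = 0 := by
  have h1 := sum_dr_mul_dr hp
  have h3 := sum_dt_mul_dt p
  simp only [Fin.sum_univ_four, vLhat_apply, dtdr_eq] at *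
  linear_combination h3 - h1

theorem rot_vL (M : ℝ) (i : Fin 3) (p : Pt) (b : Fin 4) :
    rot i (vL M p) b = (1 - mu M p) / rad p * rot i p b := by
  fin_cases i <;> fin_cases b <;> simp [rot, vL_apply, dt, dr] <;> ring

theorem rot_vLbar (M : ℝ) (i : Fin 3) (p : Pt) (b : Fin 4) :
    rot i (vLbar M p) b = -((1 - mu M p) / rad p * rot i p b) := by
  fin_cases i <;> fin_cases b <;> simp [rot, vLbar_apply, vLhat_apply, dt, dr] <;> ring

theorem along_rot_vL (M : ℝ) (i : Fin 3) (hp : p ∈ spacetime) (b : Fin 4) :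
    along (rot i) (fun q => vL M q b) p = (1 - mu M p) / rad p * rot i p b := by
  rw [along_vL_field M _ hp, sum_rot_mul_dr, sum_rot_mul_tang]; ring

theorem commute_rot_vL (M : ℝ) (i : Fin 3) (hp : p ∈ spacetime) : LieCommute (rot i) (vL M) p :=
  fun b => by rw [along_rot_vL M i hp, along_rot_field, rot_vL M i p]

theorem commute_rot_vLbar (M : ℝ) (i : Fin 3) (hp : p ∈ spacetime) :
    LieCommute (rot i) (vLbar M) p :=
  fun b => by rw [along_vLbar_field M _ hp, along_rot_vL M i hp, along_rot_field, rot_vLbar M i p]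

theorem commute_vL_vLbar (M : ℝ) (hp : p ∈ spacetime) : LieCommute (vL M) (vLbar M) p := fun b => by
  rw [along_vLbar_field M _ hp, along_vL_field M _ hp, along_vL_field M _ hp, sum_vL_mul_dr M hp,
    sum_vLbar_mul_dr M hp, sum_vL_mul_tang M hp, sum_vLbar_mul_tang M hp]
  ring

/-! ### The Laplacian on the spheres -/

theorem hSph_eq (M : ℝ) (hp : p ∈ spacetime) (a b : Fin 4) : hSph M p a b = tang p a b := by
  rw [hSph, ginv_eq M hp, vL_apply, vL_apply, vLhat_apply, vLhat_apply]; ring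

theorem gradSph_eq (M : ℝ) (φ : Pt → ℝ) (hp : p ∈ spacetime) (b : Fin 4) :
    gradSph M φ p b = ∑ c, tang p b c * pd c φ p := by
  refine Finset.sum_congr rfl fun c _ => ?_
  congr 1
  have h4 := sum_dr_mul_tang hp c
  have h5 := sum_dt_mul_tang p c
  have h6 := sum_tang_mul_tang hp b c
  simp only [hSph_eq M hp, metric_eq, dtdr_eq]
  simp only [Fin.sum_univ_four] at *
  linear_combination h6 + (dr p b + mu M p * (dt p b + dr p b)) * h4
    + (-dt p b + mu M p * (dt p b + dr p b)) * h5

theorem pd_tang (hp : p ∈ spacetime) (a b c : Fin 4) :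
    pd a (fun q => tang q b c) p
      = -(tang p a b * dr p c + dr p b * tang p a c) / rad p := by
  unfold tang
  rw [pd_sub a (differentiableAt_const _) ((dr_smooth hp b).mul (dr_smooth hp c)).diff, pd_const,
    pd_mul a (dr_smooth hp b).diff (dr_smooth hp c).diff, pd_dr hp, pd_dr hp]
  simp only [tang]
  ring

theorem sum_tang_christoffel (M : ℝ) (hp : p ∈ spacetime) (s : Fin 4) :
    ∑ a, ∑ b, tang p a b * christoffel M s a b p = -2 * (mu M p / rad p) * vLhat p s := by
  have key : ∀ a, ∑ b, tang p a b * christoffel M s a b p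
      = -(mu M p / rad p * vLhat p s) * tang p a a := by
    intro a
    have h6 := sum_tang_mul_tang hp a a
    have h4 := sum_dr_mul_tang hp a
    have h5 := sum_dt_mul_tang p a
    simp only [tang_symm p _ a] at h4 h5 h6
    simp only [christoffel_eq M hp, dtdr_eq]
    simp only [Fin.sum_univ_four] at *
    linear_combination -(mu M p / rad p * vLhat p s) * h6
      + (mu M p / rad p / 2) * ((dr p s + mu M p * vLhat p s) * (dt p a + dr p a)
        + vLhat p s * dr p a) * (h4 + h5)
      + (mu M p / rad p / 2) * vLhat p s * (dt p a + dr p a) * h4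
  simp only [key, ← Finset.mul_sum, sum_tang_diag hp]
  ring

/-- The spherical Laplacian is the Casimir operator of the rotations: `r² Δ̸ = ∑ Ω_i Ω_i`. -/
theorem lapSph_eq (M : ℝ) (hp : p ∈ spacetime) (h : ContDiffAt ℝ ∞ φ p) :
    lapSph M φ p = (rad p ^ 2)⁻¹ * ∑ i, along (rot i) (along (rot i) φ) p := by
  have hr : rad p ≠ 0 := ne_of_gt hp
  have hg : ∀ a b, pd a (fun q => gradSph M φ q b) p
      = ∑ c, (-(tang p a b * dr p c + dr p b * tang p a c) / rad p * pd c φ p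
        + tang p b c * pd a (pd c φ) p) := by
    intro a b
    rw [pd_congr a (Filter.eventually_of_mem (isOpen_spacetime.mem_nhds hp) fun q hq =>
      gradSph_eq M φ hq b),
      pd_sum a fun c => ((tang_smooth hp b c).mul (pd_smooth c h)).diff]
    refine Finset.sum_congr rfl fun c _ => ?_
    rw [pd_mul a (tang_smooth hp b c).diff (pd_smooth c h).diff, pd_tang hp]
  have hL : lapSph M φ p = -2 / rad p * (∑ c, dr p c * pd c φ p)
      + ∑ a, ∑ c, tang p a c * pd a (pd c φ) p := by
    have e1 : lapSph M φ p = ∑ a, ∑ b, tang p a b * pd a (fun q => gradSph M φ q b) p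
        - ∑ s, (∑ a, ∑ b, tang p a b * christoffel M s a b p) * gradSph M φ p s := by
      simp only [lapSph, hSph_eq M hp, cov1, mul_sub, Finset.sum_sub_distrib, Finset.sum_mul,
        Finset.mul_sum]
      congr 1
      rw [Finset.sum_comm (f := fun s a => ∑ b, tang p a b * christoffel M s a b p
        * gradSph M φ p s)]
      refine Finset.sum_congr rfl fun a _ => ?_
      rw [Finset.sum_comm]
      exact Finset.sum_congr rfl fun s _ => Finset.sum_congr rfl fun b _ => by ring
    -- The trace of the Christoffel symbols is a multiple of `L̂`, which the projected gradient annihilates.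
    have e2 : ∑ s, (∑ a, ∑ b, tang p a b * christoffel M s a b p) * gradSph M φ p s = 0 := by
      simp only [sum_tang_christoffel M hp, gradSph_eq M φ hp, Finset.mul_sum]
      rw [Finset.sum_comm]
      refine Finset.sum_eq_zero fun c _ => ?_
      have h1 := sum_vLhat_mul_tang hp c
      simp only [Fin.sum_univ_four] at *
      linear_combination -2 * (mu M p / rad p) * pd c φ p * h1
    have e3 : ∀ a, ∑ b, tang p a b * pd a (fun q => gradSph M φ q b) p
        = -(tang p a a / rad p) * (∑ c, dr p c * pd c φ p)
          + ∑ c, tang p a c * pd a (pd c φ) p := by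
      intro a
      simp only [hg, Finset.mul_sum]
      rw [Finset.sum_comm, ← Finset.sum_add_distrib]
      refine Finset.sum_congr rfl fun c _ => ?_
      have h4 := sum_dr_mul_tang hp a
      have h6 := sum_tang_mul_tang hp a a
      have h7 := sum_tang_mul_tang hp a c
      simp only [tang_symm p _ a] at h4 h6
      simp only [Fin.sum_univ_four] at *
      linear_combination -(dr p c / rad p * pd c φ p) * h6 - (tang p a c / rad p * pd c φ p) * h4
        + pd a (pd c φ) p * h7
    rw [e1, e2, sub_zero, Finset.sum_congr rfl fun a _ => e3 a]
    simp only [Finset.sum_add_distrib, ← Finset.sum_mul]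
    rw [Finset.sum_neg_distrib, ← Finset.sum_div, sum_tang_diag hp]
    ring
  rw [hL]
  simp only [along_along _ (rot_smooth _ p) h, along_rot_field, Finset.sum_add_distrib]
  have e1 : ∑ i, ∑ j, rot i (rot i p) j * pd j φ p
      = -2 * rad p * ∑ c, dr p c * pd c φ p := by
    rw [Finset.sum_comm, Finset.mul_sum]
    refine Finset.sum_congr rfl fun c _ => ?_
    rw [← Finset.sum_mul, sum_rot_rot hp]; ring
  have e2 : ∑ i, ∑ a, ∑ c, rot i p a * rot i p c * pd a (pd c φ) p
      = rad p ^ 2 * ∑ a, ∑ c, tang p a c * pd a (pd c φ) p := by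
    rw [Finset.sum_comm, Finset.mul_sum]
    refine Finset.sum_congr rfl fun a _ => ?_
    rw [Finset.sum_comm, Finset.mul_sum]
    refine Finset.sum_congr rfl fun c _ => ?_
    rw [← Finset.sum_mul, sum_rot_mul_rot hp]; ring
  rw [e1, e2]
  field_simp

end

section

variable {M : ℝ} {p : Pt} {F : Pt → Fin 4 → Fin 4 → ℝ}

/-! ### The divergence of a two-form -/

/-- The derivative `(∂_x F)(y, z)` of the components of `F`, for constant vectors `x, y, z`. -/
noncomputable def dirEv (F : Pt → Fin 4 → Fin 4 → ℝ) (p x y z : Pt) : ℝ :=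
  ∑ a, ∑ b, (∑ c, x c * pd c (fun q => F q a b) p) * y a * z b

theorem dirEv_self (hA : ∀ᶠ q in nhds p, ∀ a b, F q a b = -F q b a) (x y : Pt) :
    dirEv F p x y y = 0 := by
  have h : ∀ c a b, pd c (fun q => F q a b) p = -pd c (fun q => F q b a) p := by
    intro c a b
    rw [← pd_neg]
    exact pd_congr c (hA.mono fun q hq => hq a b)
  have e : dirEv F p x y y = -dirEv F p x y y := by
    conv_lhs => rw [dirEv, Finset.sum_comm]
    rw [dirEv, ← Finset.sum_neg_distrib]
    refine Finset.sum_congr rfl fun b _ => ?_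
    rw [← Finset.sum_neg_distrib]
    refine Finset.sum_congr rfl fun a _ => ?_
    simp only [h _ a b, mul_neg, Finset.sum_neg_distrib, neg_mul, mul_right_comm]
  linarith

theorem ev_self (hA : ∀ a b, F p a b = -F p b a) (y : Pt) : ev F p y y = 0 := by
  have := ev_antisymm hA y y
  linarith

/-- The contraction `g^{ac} Γ^s_{ac} = -□ x^s`. -/
theorem sum_ginv_christoffel (M : ℝ) (hp : p ∈ spacetime) (s : Fin 4) :
    ∑ a, ∑ c, ginv M p a c * christoffel M s c a p = -(mu M p / rad p * vLhat p s) := by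
  have key : ∀ a, ∑ c, ginv M p a c * christoffel M s c a p
      = mu M p / rad p * (-(vLhat p s * tang p a a)
      + (1 / 2) * (-(dr p s + mu M p * vLhat p s) * vLhat p a * dtdr p a
        + vLhat p s * ((dr p a + mu M p * vLhat p a) * dtdr p a - dr p a * vLhat p a))) := by
    intro a
    have h1 := sum_ginv_mul_dtdr M hp a
    have h2 := sum_ginv_mul_dr M hp a
    have h3 := sum_ginv_mul_tang M hp a a
    simp only [christoffel_eq M hp]
    simp only [Fin.sum_univ_four] at *
    linear_combination (mu M p / rad p) * (-vLhat p s * h3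
      + (1 / 2) * ((dr p s + mu M p * vLhat p s) * dtdr p a * h1
        + vLhat p s * (h2 * dtdr p a + h1 * dr p a)))
  simp only [key]
  have h1 := sum_tang_diag hp
  have h2 := sum_dtdr_mul_vLhat hp
  have h3 := sum_vLhat_mul_dr hp
  have h4 := sum_dr_mul_dr hp
  have h5 := sum_dt_mul_dr p
  simp only [Fin.sum_univ_four, dtdr_eq] at *
  linear_combination (mu M p / rad p) * (-vLhat p s * h1
    + (1 / 2) * (-(dr p s + mu M p * vLhat p s) * h2
      + vLhat p s * (h4 + h5 + mu M p * h2 - h3)))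

theorem sum_ginv_mul_christoffel (M : ℝ) (hp : p ∈ spacetime) (a s b : Fin 4) :
    ∑ c, ginv M p a c * christoffel M s c b p
      = mu M p / rad p * (-(vLhat p s * tang p a b)
      + (1 / 2) * (-(dr p s + mu M p * vLhat p s) * vLhat p a * dtdr p b
        + vLhat p s * ((dr p a + mu M p * vLhat p a) * dtdr p b - dr p b * vLhat p a))) := by
  have h1 := sum_ginv_mul_dtdr M hp a
  have h2 := sum_ginv_mul_dr M hp a
  have h3 := sum_ginv_mul_tang M hp a b
  simp only [christoffel_eq M hp]
  simp only [Fin.sum_univ_four] at *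
  linear_combination (mu M p / rad p) * (-vLhat p s * h3
    + (1 / 2) * ((dr p s + mu M p * vLhat p s) * dtdr p b * h1
      + vLhat p s * (h2 * dtdr p b + h1 * dr p b)))

/-- `∇^a F_{ab}` in terms of partial derivatives, with the trace `g^{ac} Γ^s_{ac}` evaluated. -/
theorem divF_eq (M : ℝ) (F : Pt → Fin 4 → Fin 4 → ℝ) (hp : p ∈ spacetime) (b : Fin 4) :
    divF M F p b = (∑ a, ∑ c, ginv M p a c * pd c (fun q => F q a b) p)
      + (mu M p / rad p) * (∑ s, vLhat p s * F p s b)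
      - ∑ a, ∑ s, (∑ c, ginv M p a c * christoffel M s c b p) * F p a s := by
  have e : ∑ a, ∑ c, ginv M p a c * ∑ s, christoffel M s c a p * F p s b
      = -((mu M p / rad p) * (∑ s, vLhat p s * F p s b)) := by
    have : ∑ s, (∑ a, ∑ c, ginv M p a c * christoffel M s c a p) * F p s b
        = -((mu M p / rad p) * (∑ s, vLhat p s * F p s b)) := by
      simp only [sum_ginv_christoffel M hp, Finset.mul_sum, ← Finset.sum_neg_distrib]
      exact Finset.sum_congr rfl fun s _ => by ring
    rw [← this]
    simp only [Finset.sum_mul, Finset.mul_sum]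
    rw [Finset.sum_comm (f := fun s a => ∑ c, ginv M p a c * christoffel M s c a p * F p s b)]
    refine Finset.sum_congr rfl fun a _ => ?_
    rw [Finset.sum_comm]
    exact Finset.sum_congr rfl fun s _ => Finset.sum_congr rfl fun c _ => by ring
  have e' : ∑ a, ∑ c, ginv M p a c * ∑ s, christoffel M s c b p * F p a s
      = ∑ a, ∑ s, (∑ c, ginv M p a c * christoffel M s c b p) * F p a s := by
    simp only [Finset.sum_mul, Finset.mul_sum]
    refine Finset.sum_congr rfl fun a _ => ?_
    rw [Finset.sum_comm]
    exact Finset.sum_congr rfl fun s _ => Finset.sum_congr rfl fun c _ => by ring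
  simp only [divF, cov2, mul_sub, Finset.sum_sub_distrib]
  rw [e, e']
  ring

/-- Contraction of `∇^a F_{ab}` with a vector `y` orthogonal to the spheres. -/
theorem divF_contract (M : ℝ) (hp : p ∈ spacetime) (hA : ∀ a b, F p a b = -F p b a) {y : Pt}
    (hy : ∀ a, ∑ b, y b * tang p b a = 0) :
    ∑ b, divF M F p b * y b
      = (∑ b, ∑ a, ∑ c, ginv M p a c * pd c (fun q => F q a b) p * y b)
        + (mu M p / rad p) * (ev F p (vLhat p) y
          + (∑ a, dtdr p a * y a) * ev F p (vLhat p) (dr p)) := by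
  have e : ∀ b, ∑ a, ∑ s, (∑ c, ginv M p a c * christoffel M s c b p) * F p a s
      = mu M p / rad p * (-(∑ a, ∑ s, tang p a b * vLhat p s * F p a s)
        - dtdr p b * ev F p (vLhat p) (dr p)) := by
    intro b
    have h1 := ev_self hA (vLhat p)
    have h2 := ev_antisymm hA (dr p) (vLhat p)
    simp only [sum_ginv_mul_christoffel M hp]
    simp only [ev] at *
    simp only [Fin.sum_univ_four] at *
    linear_combination mu M p / rad p * ((-dr p b / 2) * h1 + dtdr p b / 2 * h2)
  have e2 : ∑ b, (∑ a, ∑ s, tang p a b * vLhat p s * F p a s) * y b = 0 := by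
    simp only [Finset.sum_mul]
    rw [Finset.sum_comm]
    refine Finset.sum_eq_zero fun a _ => ?_
    rw [Finset.sum_comm]
    refine Finset.sum_eq_zero fun s _ => ?_
    have := hy a
    simp only [tang_symm p _ a] at this
    calc _ = (∑ b, y b * tang p a b) * (vLhat p s * F p a s) := by
          rw [Finset.sum_mul]; exact Finset.sum_congr rfl fun b _ => by ring
      _ = 0 := by rw [this, zero_mul]
  have e3 : ∑ b, (∑ a, vLhat p a * F p a b) * y b = ev F p (vLhat p) y := by
    simp only [Finset.sum_mul, ev]
    rw [Finset.sum_comm]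
    exact Finset.sum_congr rfl fun a _ => Finset.sum_congr rfl fun b _ => by ring
  have e4 : ∀ b, divF M F p b * y b
      = (∑ a, ∑ c, ginv M p a c * pd c (fun q => F q a b) p) * y b
        + mu M p / rad p * ((∑ a, vLhat p a * F p a b) * y b)
        + mu M p / rad p * ((∑ a, ∑ s, tang p a b * vLhat p s * F p a s) * y b)
        + mu M p / rad p * ev F p (vLhat p) (dr p) * (dtdr p b * y b) := by
    intro b
    rw [divF_eq M F hp, e]
    ring
  simp only [e4, Finset.sum_add_distrib, ← Finset.mul_sum, e2, e3, ← Finset.sum_mul]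
  ring

/-- The components `g^{ac} = h^{ac} - ½ (L^a L̂^c + L̂^a L^c)` of the inverse metric in the
derivative of `F`. -/
theorem sum_ginv_pd (M : ℝ) (hp : p ∈ spacetime) (y : Pt) :
    ∑ b, ∑ a, ∑ c, ginv M p a c * pd c (fun q => F q a b) p * y b
      = (∑ b, ∑ a, ∑ c, tang p a c * pd c (fun q => F q a b) p * y b)
        - (1 / 2) * (dirEv F p (vLhat p) (vL M p) y + dirEv F p (vL M p) (vLhat p) y) := by
  have e : ∀ a c, ginv M p a c = tang p a c
      - (1 / 2) * (vL M p a * vLhat p c + vLhat p a * vL M p c) := by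
    intro a c; rw [← hSph_eq M hp, hSph]; ring
  simp only [e, dirEv, Fin.sum_univ_four]
  ring

/-- `F(L̂, L) = 2 F(L̂, ∂_r)`, since `L = (1 + μ) L̂ + 2 ∂_r`. -/
theorem ev_vLhat_vL (M : ℝ) (hA : ∀ a b, F p a b = -F p b a) :
    ev F p (vLhat p) (vL M p) = 2 * ev F p (vLhat p) (dr p) := by
  have h := ev_self hA (vLhat p)
  have e : ∀ b, vL M p b = (1 + mu M p) * vLhat p b + 2 * dr p b := fun b => by
    rw [vL_apply, vLhat_apply]; ring
  simp only [ev, e, Fin.sum_univ_four] at *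
  linear_combination (1 + mu M p) * h

theorem rho_smooth (M : ℝ) (hp : p ∈ spacetime)
    (hF : ∀ a b, ContDiffAt ℝ ∞ (fun q => F q a b) p) : ContDiffAt ℝ ∞ (rho M F) p :=
  contDiffAt_const.mul (ev_smooth hF (vLhat_smooth hp) (vL_smooth M hp))

theorem along_rad_sq_mul (X : Pt → Pt) (hp : p ∈ spacetime) {φ : Pt → ℝ}
    (h : DifferentiableAt ℝ φ p) :
    along X (fun q => rad q ^ 2 * φ q) p
      = 2 * rad p * (∑ a, X p a * dr p a) * φ p + rad p ^ 2 * along X φ p := by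
  have hr := rad_smooth hp
  have e1 : along X (fun q => rad q ^ 2) p = 2 * rad p * ∑ a, X p a * dr p a := by
    simp only [pow_two]
    rw [along_mul X hr.diff hr.diff, along_rad X hp]; ring
  rw [along_mul X (hr.pow 2).diff h, e1]

/-- Derivatives of `r² ρ` along a field `X` orthogonal to the spheres: the frame components
`L̂` and `L` contribute nothing beyond a multiple of `F(L̂, L̂) = 0`. -/
theorem along_rad_sq_rho (M : ℝ) (hp : p ∈ spacetime)
    (hF : ∀ a b, ContDiffAt ℝ ∞ (fun q => F q a b) p) (hA : ∀ a b, F p a b = -F p b a)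
    {X : Pt → Pt} (hX : ∀ b, ∑ a, X p a * tang p a b = 0) :
    along X (fun q => rad q ^ 2 * rho M F q) p
      = 2 * rad p * (∑ a, X p a * dr p a) * rho M F p
        + (1 / 2) * rad p ^ 2 * dirEv F p (X p) (vLhat p) (vL M p) := by
  have h0 : ev F p (fun a => along X (fun q => vLhat q a) p) (vL M p) = 0 := by
    simp [ev, along_vLhat_field X hp, hX]
  have h1 : ev F p (vLhat p) (fun b => along X (fun q => vL M q b) p) = 0 := by
    have h := ev_self hA (vLhat p)
    simp only [ev, along_vL_field M X hp, hX, Fin.sum_univ_four] at *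
    linear_combination -(mu M p / rad p * (X p 0 * dr p 0 + X p 1 * dr p 1 + X p 2 * dr p 2
      + X p 3 * dr p 3)) * h
  have e2 : along X (rho M F) p = (1 / 2) * dirEv F p (X p) (vLhat p) (vL M p) := by
    unfold rho
    rw [along_mul X (differentiableAt_const _)
      (ev_smooth hF (vLhat_smooth hp) (vL_smooth M hp)).diff, along_const,
      along_ev X hF (vLhat_smooth hp) (vL_smooth M hp), h0, h1]
    simp only [along, dirEv]
    ring
  rw [along_rad_sq_mul X hp (rho_smooth M hp hF).diff, e2]
  ring

/-- The spherical part of the divergence in terms of rotations, for a field `Y` with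
`Ω_i(Y) = τ Ω_i`. -/
theorem sum_along_rot_ev (hp : p ∈ spacetime)
    (hF : ∀ a b, ContDiffAt ℝ ∞ (fun q => F q a b) p) (hA : ∀ a b, F p a b = -F p b a)
    {Y : Pt → Pt} (hY : SmoothField Y p) {τ : ℝ}
    (hτ : ∀ i b, along (rot i) (fun q => Y q b) p = τ * rot i p b) :
    ∑ i, along (rot i) (fun q => ev F q (rot i q) (Y q)) p
      = rad p ^ 2 * (∑ b, ∑ a, ∑ c, tang p a c * pd c (fun q => F q a b) p * Y p b)
        - 2 * rad p * ev F p (dr p) (Y p) := by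
  have h0 : ∀ i, ev F p (rot i p) (fun b => along (rot i) (fun q => Y q b) p) = 0 := by
    intro i
    have h := ev_self hA (rot i p)
    simp only [ev, hτ, Fin.sum_univ_four] at *
    linear_combination τ * h
  simp only [along_ev _ hF (rot_smooth _ p) hY, h0, add_zero, Finset.sum_add_distrib,
    along_rot_field]
  have e1 : ∑ i, ev F p (rot i (rot i p)) (Y p) = -2 * rad p * ev F p (dr p) (Y p) := by
    simp only [ev, Finset.mul_sum]
    rw [Finset.sum_comm]
    refine Finset.sum_congr rfl fun a _ => ?_
    rw [Finset.sum_comm]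
    refine Finset.sum_congr rfl fun b _ => ?_
    rw [← Finset.sum_mul, ← Finset.mul_sum, sum_rot_rot hp]; ring
  have e2 : ∑ i, ∑ a, ∑ b, along (rot i) (fun q => F q a b) p * rot i p a * Y p b
      = rad p ^ 2 * (∑ b, ∑ a, ∑ c, tang p a c * pd c (fun q => F q a b) p * Y p b) := by
    rw [Finset.sum_comm (s := Finset.univ (α := Fin 4)) (t := Finset.univ (α := Fin 4))
      (f := fun b a => ∑ c, tang p a c * pd c (fun q => F q a b) p * Y p b),
      Finset.sum_comm, Finset.mul_sum]
    refine Finset.sum_congr rfl fun a _ => ?_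
    rw [Finset.sum_comm, Finset.mul_sum]
    refine Finset.sum_congr rfl fun b _ => ?_
    simp only [along, Finset.sum_mul]
    rw [Finset.sum_comm, Finset.mul_sum]
    refine Finset.sum_congr rfl fun c _ => ?_
    calc _ = (∑ i, rot i p a * rot i p c) * (pd c (fun q => F q a b) p * Y p b) := by
          rw [Finset.sum_mul]; exact Finset.sum_congr rfl fun i _ => by ring
      _ = _ := by rw [sum_rot_mul_rot hp]; ring
  rw [e1, e2]
  ring

/-- The `L`-component of the divergence: `r² J(L) = -L(r² ρ) + ∑ Ω_i (F(Ω_i, L))`. -/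
theorem divF_vL (M : ℝ) (hp : p ∈ spacetime)
    (hF : ∀ a b, ContDiffAt ℝ ∞ (fun q => F q a b) p)
    (hA : ∀ᶠ q in nhds p, ∀ a b, F q a b = -F q b a) :
    rad p ^ 2 * ∑ b, divF M F p b * vL M p b
      = -along (vL M) (fun q => rad q ^ 2 * rho M F q) p
        + ∑ i, along (rot i) (fun q => ev F q (rot i q) (vL M q)) p := by
  have hAp := hA.self_of_nhds
  have hr : rad p ≠ 0 := ne_of_gt hp
  rw [divF_contract M hp hAp (sum_vL_mul_tang M hp), sum_ginv_pd M hp, dirEv_self hA,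
    sum_dtdr_mul_vL M hp, along_rad_sq_rho M hp hF hAp (sum_vL_mul_tang M hp),
    sum_vL_mul_dr M hp, sum_along_rot_ev hp hF hAp (vL_smooth M hp) (fun i => along_rot_vL M i hp)]
  have h1 : ev F p (dr p) (vL M p) = -((1 + mu M p) * ev F p (vLhat p) (dr p)) := by
    have h := ev_self hAp (dr p)
    have h' := ev_antisymm hAp (dr p) (vLhat p)
    have e : ∀ b, vL M p b = (1 + mu M p) * vLhat p b + 2 * dr p b := fun b => by
      rw [vL_apply, vLhat_apply]; ring
    simp only [ev, e, Fin.sum_univ_four] at *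
    linear_combination (1 + mu M p) * h' + 2 * h
  rw [h1, rho, ev_vLhat_vL M hAp]
  field_simp
  ring

/-- The `L̲`-component of the divergence: `r² J(L̲) = L̲(r² ρ) + ∑ Ω_i (F(Ω_i, L̲))`. -/
theorem divF_vLbar (M : ℝ) (hp : p ∈ spacetime)
    (hF : ∀ a b, ContDiffAt ℝ ∞ (fun q => F q a b) p)
    (hA : ∀ᶠ q in nhds p, ∀ a b, F q a b = -F q b a) :
    rad p ^ 2 * ∑ b, divF M F p b * vLbar M p b
      = along (vLbar M) (fun q => rad q ^ 2 * rho M F q) p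
        + ∑ i, along (rot i) (fun q => ev F q (rot i q) (vLbar M q)) p := by
  have hAp := hA.self_of_nhds
  have hr : rad p ≠ 0 := ne_of_gt hp
  have hτ : ∀ i b, along (rot i) (fun q => vLbar M q b) p
      = -((1 - mu M p) / rad p) * rot i p b := fun i b => by
    rw [along_vLbar_field M _ hp, along_rot_vL M i hp]; ring
  rw [divF_contract M hp hAp (sum_vLbar_mul_tang M hp), sum_ginv_pd M hp,
    along_rad_sq_rho M hp hF hAp (sum_vLbar_mul_tang M hp),
    sum_vLbar_mul_dr M hp, sum_along_rot_ev hp hF hAp (vLbar_smooth M hp) hτ]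
  have h0 : ev F p (vLhat p) (vLbar M p) = 0 := by
    have h := ev_self hAp (vLhat p)
    simp only [ev, vLbar_apply, Fin.sum_univ_four] at *
    linear_combination (1 - mu M p) * h
  have h1 : ev F p (dr p) (vLbar M p) = -((1 - mu M p) * ev F p (vLhat p) (dr p)) := by
    have h := ev_antisymm hAp (dr p) (vLhat p)
    simp only [ev, vLbar_apply, Fin.sum_univ_four] at *
    linear_combination (1 - mu M p) * h
  have h2 : ∑ a, dtdr p a * vLbar M p a = 0 := by
    have h := sum_dtdr_mul_vLhat hp
    simp only [vLbar_apply, Fin.sum_univ_four] at *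
    linear_combination (1 - mu M p) * h
  have h3 : dirEv F p (vL M p) (vLhat p) (vLbar M p) = 0 := by
    have h := dirEv_self hA (vL M p) (vLhat p)
    simp only [dirEv, vLbar_apply, ← mul_assoc, mul_right_comm _ (1 - mu M p)]  at *
    simp only [← Finset.sum_mul, h, zero_mul]
  have h4 : dirEv F p (vLhat p) (vL M p) (vLbar M p)
      = -dirEv F p (vLbar M p) (vLhat p) (vL M p) := by
    have h := dirEv_self hA (vLhat p) (fun b => vLhat p b + vL M p b)
    have h' := dirEv_self hA (vLhat p) (vLhat p)
    have h'' := dirEv_self hA (vLhat p) (vL M p)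
    simp only [dirEv, vLbar_apply, mul_add, add_mul, Finset.sum_add_distrib] at h h' h'' ⊢
    rw [h', h''] at h
    simp only [mul_assoc, ← Finset.mul_sum, mul_left_comm _ (1 - mu M p)] at h ⊢
    linear_combination (1 - mu M p) * h
  rw [h0, h1, h2, h3, h4, rho, ev_vLhat_vL M hAp]
  field_simp
  ring

end

section

variable {M : ℝ} {p : Pt} {F : Pt → Fin 4 → Fin 4 → ℝ}

/-! ### Reduction of the field equations -/

theorem christoffel_smooth (M : ℝ) (hp : p ∈ spacetime) (s a b : Fin 4) :
    ContDiffAt ℝ ∞ (christoffel M s a b) p := by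
  unfold christoffel
  exact contDiffAt_const.mul (ContDiffAt.sum fun c _ => (ginv_smooth M hp s c).mul
    (((pd_smooth a (metric_smooth M hp c b)).add (pd_smooth b (metric_smooth M hp c a))).sub
      (pd_smooth c (metric_smooth M hp a b))))

theorem divF_smooth (M : ℝ) (hp : p ∈ spacetime)
    (hF : ∀ a b, ContDiffAt ℝ ∞ (fun q => F q a b) p) (b : Fin 4) :
    ContDiffAt ℝ ∞ (fun q => divF M F q b) p := by
  unfold divF cov2
  exact ContDiffAt.sum fun a _ => ContDiffAt.sum fun c _ => (ginv_smooth M hp a c).mul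
    (((pd_smooth c (hF a b)).sub (ContDiffAt.sum fun s _ =>
      (christoffel_smooth M hp s c a).mul (hF s b))).sub (ContDiffAt.sum fun s _ =>
      (christoffel_smooth M hp s c b).mul (hF a s)))

theorem cov1_sub_cov1 (M : ℝ) (w : Pt → Fin 4 → ℝ) (a b : Fin 4) (p : Pt) :
    cov1 M w a b p - cov1 M w b a p = pd a (fun q => w q b) p - pd b (fun q => w q a) p := by
  simp only [cov1, christoffel_symm M _ a b]
  ring

theorem cov1_congr_neg {w v : Pt → Fin 4 → ℝ} (h : ∀ᶠ q in nhds p, ∀ b, w q b = -v q b)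
    (a b : Fin 4) : cov1 M w a b p = -cov1 M v a b p := by
  have h0 := h.self_of_nhds
  rw [cov1, cov1, pd_congr a (h.mono fun q hq => hq b), pd_neg]
  simp only [h0, mul_neg, Finset.sum_neg_distrib]
  ring

theorem cov2_antisymm (hA : ∀ᶠ q in nhds p, ∀ a b, F q a b = -F q b a) (c a b : Fin 4) :
    cov2 M F c a b p = -cov2 M F c b a p := by
  have h0 := hA.self_of_nhds
  rw [cov2, cov2, pd_congr c (hA.mono fun q hq => hq a b), pd_neg]
  simp only [h0 _ b, h0 a _, mul_neg, Finset.sum_neg_distrib]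
  ring

/-- The Christoffel symbols drop out of `∇_{[a} F_{bc]}`. -/
theorem cov2_cyclic (hA : ∀ a b, F p a b = -F p b a) (a b c : Fin 4) :
    cov2 M F a b c p + cov2 M F b c a p + cov2 M F c a b p
      = pd a (fun q => F q b c) p + pd b (fun q => F q c a) p + pd c (fun q => F q a b) p := by
  simp only [cov2, christoffel_symm M _ b a, christoffel_symm M _ c a, christoffel_symm M _ c b,
    hA a _, hA b _, hA c _, mul_neg, Finset.sum_neg_distrib]
  ring

/-- Since `½ (g^{ac} g^{bd} - g^{ad} g^{bc}) ∇_a F_{cd} = ∇_a F^{ab}`, the field equation says that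
`N = -div F`. -/
theorem hDeltaGrad_eq (M : ℝ) (hp : p ∈ spacetime)
    (hA : ∀ᶠ q in nhds p, ∀ a b, F q a b = -F q b a)
    (hf : ∀ b, ∑ a, ∑ c, ∑ d, hTensor M F p a b c d * cov2 M F a c d p = 0) (b : Fin 4) :
    hDeltaGrad M F p b = -divF M F p b := by
  have hdiv : ∀ d, divF M F p d = ∑ a, ∑ c, ginv M p a c * cov2 M F a c d p := by
    intro d
    rw [divF, Finset.sum_comm]
    exact Finset.sum_congr rfl fun a _ => Finset.sum_congr rfl fun c _ => by
      rw [ginv_symm M hp]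
  have h1 : ∀ e, ∑ a, ∑ c, ∑ d, ginv M p a c * ginv M p e d * cov2 M F a c d p
      = ∑ d, ginv M p e d * divF M F p d := by
    intro e
    simp only [hdiv, Finset.mul_sum]
    rw [Finset.sum_comm (f := fun d a => ∑ c, ginv M p e d * (ginv M p a c * cov2 M F a c d p))]
    refine Finset.sum_congr rfl fun a _ => ?_
    rw [Finset.sum_comm]
    exact Finset.sum_congr rfl fun d _ => Finset.sum_congr rfl fun c _ => by ring
  have h2 : ∀ e, ∑ a, ∑ c, ∑ d, ginv M p a d * ginv M p e c * cov2 M F a c d p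
      = -∑ d, ginv M p e d * divF M F p d := by
    intro e
    rw [← h1, ← Finset.sum_neg_distrib]
    refine Finset.sum_congr rfl fun a _ => ?_
    rw [Finset.sum_comm, ← Finset.sum_neg_distrib]
    refine Finset.sum_congr rfl fun d _ => ?_
    rw [← Finset.sum_neg_distrib]
    exact Finset.sum_congr rfl fun c _ => by rw [cov2_antisymm hA a c d]; ring
  have h3 : ∀ e, ∑ a, ∑ c, ∑ d, hDelta M F p a e c d * cov2 M F a c d p
      = -∑ d, ginv M p e d * divF M F p d := by
    intro e
    have h := hf e
    have e1 : ∀ a c d, hTensor M F p a e c d * cov2 M F a c d p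
        = (1 / 2) * (ginv M p a c * ginv M p e d * cov2 M F a c d p)
          - (1 / 2) * (ginv M p a d * ginv M p e c * cov2 M F a c d p)
          + hDelta M F p a e c d * cov2 M F a c d p := by
      intro a c d; rw [hTensor]; ring
    simp only [e1, Finset.sum_add_distrib, Finset.sum_sub_distrib, ← Finset.mul_sum, h1, h2] at h
    linarith
  rw [hDeltaGrad]
  simp only [h3, mul_neg, Finset.sum_neg_distrib, Finset.mul_sum]
  rw [Finset.sum_comm]
  congr 1
  have h4 : ∀ d, ∑ e, metric M p b e * (ginv M p e d * divF M F p d)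
      = (1 : Matrix (Fin 4) (Fin 4) ℝ) b d * divF M F p d := by
    intro d
    rw [← metric_mul_ginv M hp, Matrix.mul_apply, Finset.sum_mul]
    exact Finset.sum_congr rfl fun e _ => by ring
  simp [h4, Matrix.one_apply]

/-! ### The wave equation for `ρ` -/

/-- Closedness on the triple `Ω_i, L̲, L`:
`L̲(F(Ω_i, L)) - L(F(Ω_i, L̲)) = Ω_i(F(L̲, L)) = 2 (1 - μ) Ω_i ρ`. -/
theorem along_ev_rot (M : ℝ) (hp : p ∈ spacetime)
    (hF : ∀ a b, ContDiffAt ℝ ∞ (fun q => F q a b) p)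
    (hA : ∀ᶠ q in nhds p, ∀ a b, F q a b = -F q b a)
    (hdF : ∀ a b c, pd a (fun q => F q b c) p + pd b (fun q => F q c a) p
      + pd c (fun q => F q a b) p = 0) (i : Fin 3) :
    along (vLbar M) (fun q => ev F q (rot i q) (vL M q)) p
        - along (vL M) (fun q => ev F q (rot i q) (vLbar M q)) p
      = 2 * (1 - mu M p) * along (rot i) (rho M F) p := by
  have h := extDeriv_two hF hA.self_of_nhds hdF (rot_smooth i p) (vLbar_smooth M hp)
    (vL_smooth M hp) (commute_rot_vLbar M i hp) (commute_vL_vLbar M hp).symm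
    (commute_rot_vL M i hp).symm
  have e1 : along (vLbar M) (fun q => ev F q (vL M q) (rot i q)) p
      = -along (vLbar M) (fun q => ev F q (rot i q) (vL M q)) p := by
    rw [← along_neg]
    exact along_congr _ (hA.mono fun q hq => ev_antisymm hq _ _)
  have e2 : (fun q => ev F q (vLbar M q) (vL M q)) = fun q => 2 * (1 - mu M q) * rho M F q := by
    funext q
    simp only [rho, ev, vLbar_apply, Finset.mul_sum]
    exact Finset.sum_congr rfl fun a _ => Finset.sum_congr rfl fun b _ => by ring
  have hm : ContDiffAt ℝ ∞ (fun q => 1 - mu M q) p := contDiffAt_const.sub (mu_smooth M hp)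
  rw [e1, e2, along_mul _ (contDiffAt_const.mul hm).diff (rho_smooth M hp hF).diff,
    along_rot_mu M i hp] at h
  linarith

/-- The Fackerell--Ipser equation for a closed two-form with divergence `J`. -/
theorem wave_rho (M : ℝ) {U : Set Pt} (hU : IsOpen U) (hUS : U ⊆ spacetime)
    (hF : ∀ p ∈ U, ∀ a b, ContDiffAt ℝ ∞ (fun q => F q a b) p)
    (hA : ∀ p ∈ U, ∀ a b, F p a b = -F p b a)
    (hdF : ∀ p ∈ U, ∀ a b c, pd a (fun q => F q b c) p + pd b (fun q => F q c a) p
      + pd c (fun q => F q a b) p = 0) (hpU : p ∈ U) :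
    -(rad p ^ 2)⁻¹ * along (vL M) (along (vLbar M) (fun q => rad q ^ 2 * rho M F q)) p
        + (1 - mu M p) * lapSph M (rho M F) p
      = (1 / 2) * (2 * ((1 - mu M p) / rad p) * (-∑ b, divF M F p b * vLbar M p b)
          - 2 * ((1 - mu M p) / rad p) * ∑ b, divF M F p b * vL M p b
        + ∑ b, ∑ a, vL M p b * vLbar M p a *
          (pd a (fun q => divF M F q b) p - pd b (fun q => divF M F q a) p)) := by
  have hp := hUS hpU
  have hr : rad p ≠ 0 := ne_of_gt hp
  have hev : ∀ {P : Pt → Prop}, (∀ q ∈ U, P q) → ∀ q ∈ U, ∀ᶠ x in nhds q, P x :=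
    fun h q hq => Filter.eventually_of_mem (hU.mem_nhds hq) h
  have hFp := hF p hpU
  have hrho := rho_smooth M hp hFp
  have hR : ContDiffAt ℝ ∞ (fun q => rad q ^ 2 * rho M F q) p := ((rad_smooth hp).pow 2).mul hrho
  have sL := vL_smooth M hp
  have sB := vLbar_smooth M hp
  have sJ := divF_smooth M hp hFp
  have sJL : DifferentiableAt ℝ (fun q => ∑ b, divF M F q b * vL M q b) p :=
    (ContDiffAt.sum fun b _ => (sJ b).mul (sL b)).diff
  have sJB : DifferentiableAt ℝ (fun q => ∑ b, divF M F q b * vLbar M q b) p :=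
    (ContDiffAt.sum fun b _ => (sJ b).mul (sB b)).diff
  have sRL : ∀ i, ContDiffAt ℝ ∞ (fun q => ev F q (rot i q) (vL M q)) p := fun i =>
    ev_smooth hFp (rot_smooth i p) sL
  have sRB : ∀ i, ContDiffAt ℝ ∞ (fun q => ev F q (rot i q) (vLbar M q)) p := fun i =>
    ev_smooth hFp (rot_smooth i p) sB
  rw [extDeriv_one (fun b => (sJ b).diff) sB sL (commute_vL_vLbar M hp).symm, lapSph_eq M hp hrho]
  -- `L̲` of the identity `divF_vL`, and below `L` of `divF_vLbar`, with `L̲` and `L` moved past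
  -- the fields they commute with.
  have e1 : along (vLbar M) (fun q => rad q ^ 2 * ∑ b, divF M F q b * vL M q b) p
      = -along (vL M) (along (vLbar M) (fun q => rad q ^ 2 * rho M F q)) p
        + ∑ i, along (rot i) (along (vLbar M) (fun q => ev F q (rot i q) (vL M q))) p := by
    rw [along_congr _ (hev (fun q hq => divF_vL M (hUS hq) (hF q hq) (hev hA q hq)) p hpU),
      along_add _ (along_smooth sL hR).neg.diff (ContDiffAt.sum fun i _ =>
        along_smooth (rot_smooth i p) (sRL i)).diff, along_neg,
      along_comm sB sL hR (commute_vL_vLbar M hp).symm,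
      along_sum _ fun i => (along_smooth (rot_smooth i p) (sRL i)).diff]
    congr 1
    exact Finset.sum_congr rfl fun i _ =>
      along_comm sB (rot_smooth i p) (sRL i) (commute_rot_vLbar M i hp).symm
  have e2 : along (vL M) (fun q => rad q ^ 2 * ∑ b, divF M F q b * vLbar M q b) p
      = along (vL M) (along (vLbar M) (fun q => rad q ^ 2 * rho M F q)) p
        + ∑ i, along (rot i) (along (vL M) (fun q => ev F q (rot i q) (vLbar M q))) p := by
    rw [along_congr _ (hev (fun q hq => divF_vLbar M (hUS hq) (hF q hq) (hev hA q hq)) p hpU),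
      along_add _ (along_smooth sB hR).diff (ContDiffAt.sum fun i _ =>
        along_smooth (rot_smooth i p) (sRB i)).diff,
      along_sum _ fun i => (along_smooth (rot_smooth i p) (sRB i)).diff]
    congr 1
    exact Finset.sum_congr rfl fun i _ =>
      along_comm sL (rot_smooth i p) (sRB i) (commute_rot_vL M i hp).symm
  have e3 : ∀ i, along (rot i) (along (vLbar M) (fun q => ev F q (rot i q) (vL M q))) p
      - along (rot i) (along (vL M) (fun q => ev F q (rot i q) (vLbar M q))) p
      = 2 * (1 - mu M p) * along (rot i) (along (rot i) (rho M F)) p := by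
    intro i
    have hm : ContDiffAt ℝ ∞ (fun q => 2 * (1 - mu M q)) p :=
      contDiffAt_const.mul (contDiffAt_const.sub (mu_smooth M hp))
    rw [← along_sub _ (along_smooth sB (sRL i)).diff (along_smooth sL (sRB i)).diff,
      along_congr _ (hev (fun q hq =>
        along_ev_rot M (hUS hq) (hF q hq) (hev hA q hq) (hdF q hq) i) p hpU),
      along_mul _ hm.diff (along_smooth (rot_smooth i p) hrho).diff, along_rot_mu M i hp]
    ring
  have e4 : ∑ i, along (rot i) (along (vLbar M) (fun q => ev F q (rot i q) (vL M q))) p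
      - ∑ i, along (rot i) (along (vL M) (fun q => ev F q (rot i q) (vLbar M q))) p
      = 2 * (1 - mu M p) * ∑ i, along (rot i) (along (rot i) (rho M F)) p := by
    rw [← Finset.sum_sub_distrib, Finset.mul_sum]
    exact Finset.sum_congr rfl fun i _ => e3 i
  rw [along_rad_sq_mul _ hp sJL, sum_vLbar_mul_dr M hp] at e1
  rw [along_rad_sq_mul _ hp sJB, sum_vL_mul_dr M hp] at e2
  field_simp
  linear_combination e2 - e1 - e4

end

end MBI

theorem lemma10p1 (M : ℝ) (hM : 0 < M) (U : Set MBI.Pt) (hU : IsOpen U)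
    (hUS : U ⊆ MBI.spacetime) (F : MBI.Pt → Fin 4 → Fin 4 → ℝ)
    (hF : MBI.IsSmoothTwoForm U F) (hMBI : MBI.IsMBISolution M U F) :
    ∀ p ∈ U,
      -(MBI.rad p ^ 2)⁻¹ *
            MBI.along (MBI.vL M)
              (MBI.along (MBI.vLbar M) (fun q => MBI.rad q ^ 2 * MBI.rho M F q)) p
          + (1 - MBI.mu M p) * MBI.lapSph M (MBI.rho M F) p
        = -(1 / 2) * (MBI.NL1 M F p + MBI.NL2 M F p) ∧
      MBI.NL2 M F p =
        ∑ b, ∑ a, MBI.vL M p b * MBI.vLbar M p a *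
          (-MBI.cov1 M (MBI.divF M F) a b p + MBI.cov1 M (MBI.divF M F) b a p) := by

  have hFs : ∀ p ∈ U, ∀ a b, ContDiffAt ℝ ∞ (fun q => F q a b) p := fun p hp a b =>
    (hF.smooth a b).contDiffAt (hU.mem_nhds hp)
  have hA : ∀ p ∈ U, ∀ᶠ q in nhds p, ∀ a b, F q a b = -F q b a := fun p hp =>
    Filter.eventually_of_mem (hU.mem_nhds hp) hF.antisymm
  have hN : ∀ p ∈ U, ∀ b, MBI.hDeltaGrad M F p b = -MBI.divF M F p b := fun p hp =>
    MBI.hDeltaGrad_eq M (hUS hp) (hA p hp) (hMBI.field p hp)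
  have hdF : ∀ p ∈ U, ∀ a b c, MBI.pd a (fun q => F q b c) p + MBI.pd b (fun q => F q c a) p
      + MBI.pd c (fun q => F q a b) p = 0 := fun p hp a b c => by
    rw [← MBI.cov2_cyclic (M := M) (hF.antisymm p hp)]
    exact hMBI.closed p hp a b c
  intro p hp
  have hNe : ∀ a b, MBI.cov1 M (MBI.hDeltaGrad M F) a b p = -MBI.cov1 M (MBI.divF M F) a b p :=
    MBI.cov1_congr_neg (Filter.eventually_of_mem (hU.mem_nhds hp) hN)
  have h2 : MBI.NL2 M F p = ∑ b, ∑ a, MBI.vL M p b * MBI.vLbar M p a *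
      (-MBI.cov1 M (MBI.divF M F) a b p + MBI.cov1 M (MBI.divF M F) b a p) := by
    simp only [MBI.NL2, hNe, sub_neg_eq_add]
  refine ⟨?_, h2⟩
  have h3 : MBI.NL2 M F p = -∑ b, ∑ a, MBI.vL M p b * MBI.vLbar M p a *
      (MBI.pd a (fun q => MBI.divF M F q b) p - MBI.pd b (fun q => MBI.divF M F q a) p) := by
    simp only [h2, ← MBI.cov1_sub_cov1 M, ← Finset.sum_neg_distrib]
    exact Finset.sum_congr rfl fun b _ => Finset.sum_congr rfl fun a _ => by ring
  rw [MBI.wave_rho M hU hUS hFs hF.antisymm hdF hp, h3, MBI.NL1]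
  simp only [hN p hp, neg_mul, Finset.sum_neg_distrib]
  ring
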